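/- Let $n\ge 2$ and $k\ge 1$ be integers, let $\mathcal G$ be an undirected graph without self-loops on the vertex set $\{1,\dots,k\}$ with edge set $\mathcal E$ and adjacency matrix $(a_{ij})$, and for every edge $(i,j)\in\mathcal E$ let $y_{ij}=y_{ji}\in\mathbb R^n$ be a fixed unit vector. Put $M_{ij}=y_{ij}y_{ij}^T$ and $\operatorname{sk}(X)=\tfrac12(X-X^T)$. On $SO(n)^k$ consider the partial-state coupling law $$\tfrac{d}{dt}Q_i \;=\; Q_i\sum_{\{j\,:\,(i,j)\in\mathcal E\}}\operatorname{sk}(Q_i^TM_{ij}Q_j),\qquad i=1,\dots,k,$$ which is the negative gradient flow of $f_o=\tfrac12\sum_{(i,j)\in\mathcal E}\|Q_i^Ty_{ij}-Q_j^Ty_{ij}\|_2^2$. Let $$C_s=\{Q\in SO(n)^k: Q_1=\dots=Q_k\},\qquad C_o=\{Q\in SO(n)^k: Q_i^Ty_{ij}=Q_j^Ty_{ij}\ \ \forall (i,j)\in\mathcal E\}.$$ Let $L^g\in\mathbb R^{kn\times kn}$ be the matrix with $n\times n$ blocks $L^g_{ij}=-a_{ij}M_{ij}$ for $i\ne j$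 and $L^g_{ii}=\sum_{j}a_{ij}M_{ij}$. For $X=(X_1,\dots,X_k)\in(\mathbb R^{n\times n})^k$ let $\operatorname{vec}(X)\in\mathbb R^{n^2k}$ be the vector obtained by stacking the columns of the $kn\times n$ matrix with blocks $X_1,\dots,X_k$ placed below one another. Let $d(Q,S)$ denote the distance of $Q\in SO(n)^k$ to a set $S\subseteq SO(n)^k$ with respect to $d(Q,P)=(\sum_i\|Q_i-P_i\|_F^2)^{1/2}$. A set $S$ is called locally exponentially stable if there are $\delta,c,r>0$ such that every solution with $d(Q(0),S)<\delta$ satisfies $d(Q(t),S)\le c\,e^{-rt}\,d(Q(0),S)$ for all $t\ge0$. It is called locally asymptotically stable if for each $\varepsilon>0$ there is $\delta>0$ such that $d(Q(0),S)<\delta$ implies $d(Q(t),S)<\varepsilon$ for all $t\ge0$, and there is $\delta>0$ such that $d(Q(0),S)<\delta$ implies $d(Q(t),S)\to0$ as $t\to\infty$. (a) If $\operatorname{rank}L^g=n(k-1)$, then $C_o=C_s$ and this set is locally exponentially stable. (b) Let $V\in\mathbb R^{n^2k\times kn(n-1)/2}$ be any matrix whose columns form an orthonormal basis of $\operatorname{vec}(\mathfrak{so}(n)^k)$,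 where $\mathfrak{so}(n)$ is the space of skew-symmetric $n\times n$ matrices. Then $C_s$ is locally exponentially stable if and only if $$\operatorname{rank}\bigl(V^T(I_n\otimes L^g)V\bigr)=(k-1)\tfrac{n(n-1)}2 .$$ Moreover, non-exponential asymptotic stability of $C_s$ is possible if the rank condition in (b) fails: there are $n\ge2$, $k\ge1$, a graph and reference vectors as above for which the rank condition in (b) does not hold and $C_s$ is locally asymptotically stable but not locally exponentially stable. -/

import Mathlib

open Matrix
open scoped Kronecker

noncomputable section

namespace PartialSync

/-- The rotation group `SO(n)`. -/
abbrev SO (n : ℕ) := Matrix.specialOrthogonalGroup (Fin n) ℝ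

/-- A state of the network: one rotation for each of the `k` agents, an element of `SO(n)^k`. -/
abbrev State (k n : ℕ) := Fin k → SO n

/-- The Euclidean space `ℝ^(n²k)` in which `vec` takes its values. A coordinate is indexed by
`(c, i, r)`: column `c`, agent `i`, row `r`. -/
abbrev VecSpace (k n : ℕ) := EuclideanSpace ℝ (Fin n × (Fin k × Fin n))

/-- Reference vectors on the edges of `G`: unit vectors that do not depend on the orientation
of the edge. Values of `y` off the edges are irrelevant. -/
structure IsReference {k n : ℕ} (G : SimpleGraph (Fin k))
    (y : Fin k → Fin k → EuclideanSpace ℝ (Fin n)) : Prop where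
  symm : ∀ i j, G.Adj i j → y i j = y j i
  unit : ∀ i j, G.Adj i j → ‖y i j‖ = 1

/-- The rank one projector `M = y yᵀ`. -/
def proj {n : ℕ} (y : EuclideanSpace ℝ (Fin n)) : Matrix (Fin n) (Fin n) ℝ :=
  Matrix.of fun a b => y a * y b

/-- The skew-symmetric part `sk(X) = (X - Xᵀ) / 2`. -/
def sk {n : ℕ} (X : Matrix (Fin n) (Fin n) ℝ) : Matrix (Fin n) (Fin n) ℝ :=
  (1 / 2 : ℝ) • (X - Xᵀ)

/-- State synchronization set `C_s`. -/
def stateSync (k n : ℕ) : Set (State k n) :=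
  {Q | ∀ i j, Q i = Q j}

/-- Output synchronization set `C_o`. -/
def outputSync {k n : ℕ} (G : SimpleGraph (Fin k))
    (y : Fin k → Fin k → EuclideanSpace ℝ (Fin n)) : Set (State k n) :=
  {Q | ∀ i j, G.Adj i j →
    (Q i : Matrix (Fin n) (Fin n) ℝ)ᵀ *ᵥ (y i j).ofLp =
      (Q j : Matrix (Fin n) (Fin n) ℝ)ᵀ *ᵥ (y i j).ofLp}

/-- The `i`-th component of the right-hand side of the partial-state coupling law,
`Q_i ∑_{j ~ i} sk(Q_iᵀ M_ij Q_j)`. -/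
def couplingField {k n : ℕ} (G : SimpleGraph (Fin k)) [DecidableRel G.Adj]
    (y : Fin k → Fin k → EuclideanSpace ℝ (Fin n)) (Q : State k n) (i : Fin k) :
    Matrix (Fin n) (Fin n) ℝ :=
  (Q i : Matrix (Fin n) (Fin n) ℝ) *
    ∑ j ∈ G.neighborFinset i,
      sk ((Q i : Matrix (Fin n) (Fin n) ℝ)ᵀ * proj (y i j) * (Q j : Matrix (Fin n) (Fin n) ℝ))

/-- `Q` is a solution on `[0, ∞)` of `d/dt Q_i = Q_i ∑_{j ~ i} sk(Q_iᵀ M_ij Q_j)`; the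
derivative of a matrix-valued function is taken entrywise. -/
def IsSolution {k n : ℕ} (G : SimpleGraph (Fin k)) [DecidableRel G.Adj]
    (y : Fin k → Fin k → EuclideanSpace ℝ (Fin n)) (Q : ℝ → State k n) : Prop :=
  ∀ t : ℝ, 0 ≤ t → ∀ i a b,
    HasDerivWithinAt (fun s => (Q s i : Matrix (Fin n) (Fin n) ℝ) a b)
      (couplingField G y (Q t) i a b) (Set.Ici 0) t

/-- The column-stacking `vec` of the `kn × n` matrix obtained by placing `X_1, …, X_k` below
one another. -/
def vecStack {k n : ℕ} (X : Fin k → Matrix (Fin n) (Fin n) ℝ) : VecSpace k n :=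
  WithLp.toLp 2 (Matrix.vec (Matrix.of fun (p : Fin k × Fin n) (c : Fin n) => X p.1 p.2 c))

/-- A state of the network as a vector. The Euclidean distance between two such vectors is
`(∑_i ‖Q_i - P_i‖_F²)^(1/2)`, with `‖·‖_F` the Frobenius norm. -/
def stateVec {k n : ℕ} (Q : State k n) : VecSpace k n :=
  vecStack fun i => (Q i : Matrix (Fin n) (Fin n) ℝ)

/-- Distance of a state to a set of states. -/
def distTo {k n : ℕ} (S : Set (State k n)) (Q : State k n) : ℝ :=
  Metric.infDist (stateVec Q) (stateVec '' S)

/-- Local exponential stability of a set `S` under the coupling law. -/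
def LocallyExponentiallyStable {k n : ℕ} (G : SimpleGraph (Fin k)) [DecidableRel G.Adj]
    (y : Fin k → Fin k → EuclideanSpace ℝ (Fin n)) (S : Set (State k n)) : Prop :=
  ∃ δ > 0, ∃ c > 0, ∃ r > 0, ∀ Q : ℝ → State k n, IsSolution G y Q →
    distTo S (Q 0) < δ →
      ∀ t : ℝ, 0 ≤ t → distTo S (Q t) ≤ c * Real.exp (-r * t) * distTo S (Q 0)

/-- Local asymptotic stability of a set `S` under the coupling law: stability together with
local attractivity. -/
def LocallyAsymptoticallyStable {k n : ℕ} (G : SimpleGraph (Fin k)) [DecidableRel G.Adj]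
    (y : Fin k → Fin k → EuclideanSpace ℝ (Fin n)) (S : Set (State k n)) : Prop :=
  (∀ ε > 0, ∃ δ > 0, ∀ Q : ℝ → State k n, IsSolution G y Q →
    distTo S (Q 0) < δ → ∀ t : ℝ, 0 ≤ t → distTo S (Q t) < ε) ∧
  (∃ δ > 0, ∀ Q : ℝ → State k n, IsSolution G y Q →
    distTo S (Q 0) < δ →
      Filter.Tendsto (fun t => distTo S (Q t)) Filter.atTop (nhds 0))

/-- The generalized Laplacian `L^g`, with blocks `-a_ij M_ij` for `i ≠ j` and
`∑_j a_ij M_ij` for `i = j`, where `(a_ij)` is the adjacency matrix of the graph. -/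
def genLaplacian {k n : ℕ} (G : SimpleGraph (Fin k)) [DecidableRel G.Adj]
    (y : Fin k → Fin k → EuclideanSpace ℝ (Fin n)) :
    Matrix (Fin k × Fin n) (Fin k × Fin n) ℝ :=
  Matrix.of fun p q =>
    if p.1 = q.1 then ∑ j, G.adjMatrix ℝ p.1 j * proj (y p.1 j) p.2 q.2
    else -(G.adjMatrix ℝ p.1 q.1 * proj (y p.1 q.1) p.2 q.2)

/-- The columns of `V` form an orthonormal basis of `vec(so(n)^k)`. -/
def IsSkewBasis {k n : ℕ}
    (V : Matrix (Fin n × (Fin k × Fin n)) (Fin (k * (n * (n - 1) / 2))) ℝ) : Prop :=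
  Orthonormal ℝ (fun c => (WithLp.toLp 2 (V.col c) : VecSpace k n)) ∧
  (Submodule.span ℝ (Set.range fun c => (WithLp.toLp 2 (V.col c) : VecSpace k n)) :
      Set (VecSpace k n)) =
    vecStack '' {Ω | ∀ i, Ω i ∈ LieAlgebra.Orthogonal.so (Fin n) ℝ}

end PartialSync

end

/-! Everything in (a) and (b) passes through one linear condition, `InfRigid`: a tuple of skew
matrices with `M_ij (Ω_i - Ω_j) = 0` on all edges is constant. The form `tr(Xᵀ L^g X)` is half the
sum of `‖M_ij (X_i - X_j)‖²` over oriented edges, so these tuples are the kernel of `Vᵀ (I ⊗ L^g)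
V`. By rank-nullity, the rank condition in (b) says that this kernel consists of the common
rotations only (`IsSkewBasis.rank_eq_iff`). The condition in (a) says the same for arbitrary
matrices, which yields both `C_o = C_s` and `InfRigid`.

Rigidity gives exponential stability. Let `V` (`spread`) be the sum of `‖Q_i - Q_j‖²` over all pairs
and `W` (`edgeEnergy`) the output disagreement. Expanding at synchronization gives `V' ≤ -2k W + 3k³
V^(3/2)` (`spreadRate_le`). Since rotations near synchronization are skew to first order relative to
one agent, rigidity yields `V ≤ C W` there (`InfRigid.exists_spread_le`). Hence `V' ≤ -c V` for
small `V`, and `√V` is comparable to the distance to `C_s`.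

Exponential stability gives rigidity, without linearizing the flow. `W` does not increase and the
speed is at most a multiple of `√W`; if the distance halves within a fixed time, the solution has
covered half of it, so the distance is at most `C √W` initially
(`LocallyExponentiallyStable.exists_error_bound`). Testing this bound on `Q_i = exp(t Ω_i)` and
letting `t → 0` gives `Ω_i = Ω_j`. Solutions through arbitrary initial states are needed here
(`exists_isSolution`).

The example is a triangle in `SO(3)` with three coplanar axes. Angular velocities along the axes can
be chosen to cancel around the triangle, so rigidity fails. Yet no other equilibria lie near `C_s`
(`triangle_equilibrium`), and a LaSalle argument with the Lyapunov function `W` gives asymptotic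
stability. -/

noncomputable section
namespace PartialSync

attribute [local instance] Matrix.frobeniusNormedAddCommGroup Matrix.frobeniusNormedSpace

/-! ### Frobenius inner product, skew parts, rotations and projectors -/

section Frobenius

variable {n : ℕ}

/-- The Frobenius inner product. -/
def frobInner (X Y : Matrix (Fin n) (Fin n) ℝ) : ℝ := (Xᵀ * Y).trace

theorem frobInner_eq_sum (X Y : Matrix (Fin n) (Fin n) ℝ) :
    frobInner X Y = ∑ a, ∑ b, X a b * Y a b := by
  simp only [frobInner, Matrix.trace, Matrix.diag_apply, Matrix.mul_apply, Matrix.transpose_apply]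
  exact Finset.sum_comm

theorem norm_sq_eq_sum (X : Matrix (Fin n) (Fin n) ℝ) :
    ‖X‖ ^ 2 = ∑ a, ∑ b, X a b ^ 2 := by
  have h : 0 ≤ ∑ a, ∑ b, X a b ^ 2 :=
    Finset.sum_nonneg fun _ _ => Finset.sum_nonneg fun _ _ => sq_nonneg _
  rw [Matrix.frobenius_norm_def]
  simp only [Real.norm_eq_abs, Real.rpow_two, sq_abs]
  rw [← Real.sqrt_eq_rpow, Real.sq_sqrt h]

theorem frobInner_self (X : Matrix (Fin n) (Fin n) ℝ) : frobInner X X = ‖X‖ ^ 2 := by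
  rw [norm_sq_eq_sum, frobInner_eq_sum]
  simp only [sq]

theorem frobInner_comm (X Y : Matrix (Fin n) (Fin n) ℝ) : frobInner X Y = frobInner Y X := by
  simp only [frobInner_eq_sum, mul_comm]

theorem frobInner_add_left (X Y Z : Matrix (Fin n) (Fin n) ℝ) :
    frobInner (X + Y) Z = frobInner X Z + frobInner Y Z := by
  simp [frobInner, Matrix.transpose_add, Matrix.add_mul]

theorem frobInner_sub_left (X Y Z : Matrix (Fin n) (Fin n) ℝ) :
    frobInner (X - Y) Z = frobInner X Z - frobInner Y Z := by
  simp [frobInner, Matrix.transpose_sub, Matrix.sub_mul]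

theorem frobInner_sub_right (X Y Z : Matrix (Fin n) (Fin n) ℝ) :
    frobInner X (Y - Z) = frobInner X Y - frobInner X Z := by
  simp [frobInner, Matrix.mul_sub]

theorem frobInner_neg_right (X Y : Matrix (Fin n) (Fin n) ℝ) :
    frobInner X (-Y) = -frobInner X Y := by
  simp [frobInner]

theorem frobInner_smul_left (c : ℝ) (X Y : Matrix (Fin n) (Fin n) ℝ) :
    frobInner (c • X) Y = c * frobInner X Y := by
  simp [frobInner]

theorem frobInner_smul_right (c : ℝ) (X Y : Matrix (Fin n) (Fin n) ℝ) :
    frobInner X (c • Y) = c * frobInner X Y := by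
  simp [frobInner]

theorem frobInner_sum_left {ι : Type*} (s : Finset ι) (X : ι → Matrix (Fin n) (Fin n) ℝ)
    (Y : Matrix (Fin n) (Fin n) ℝ) :
    frobInner (∑ i ∈ s, X i) Y = ∑ i ∈ s, frobInner (X i) Y := by
  simp [frobInner, Matrix.transpose_sum, Matrix.sum_mul, Matrix.trace_sum]

theorem frobInner_sum_right {ι : Type*} (s : Finset ι) (X : Matrix (Fin n) (Fin n) ℝ)
    (Y : ι → Matrix (Fin n) (Fin n) ℝ) :
    frobInner X (∑ i ∈ s, Y i) = ∑ i ∈ s, frobInner X (Y i) := by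
  simp [frobInner, Matrix.mul_sum, Matrix.trace_sum]

theorem frobInner_mul_right (X Y Z : Matrix (Fin n) (Fin n) ℝ) :
    frobInner X (Y * Z) = frobInner (Yᵀ * X) Z := by
  simp [frobInner, Matrix.mul_assoc]

theorem frobInner_mul_right' (X Y Z : Matrix (Fin n) (Fin n) ℝ) :
    frobInner X (Y * Z) = frobInner (X * Zᵀ) Y := by
  rw [frobInner, frobInner, Matrix.transpose_mul, Matrix.transpose_transpose, Matrix.mul_assoc,
    Matrix.trace_mul_comm Z, Matrix.mul_assoc]

theorem frobInner_transpose (X Y : Matrix (Fin n) (Fin n) ℝ) :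
    frobInner Xᵀ Yᵀ = frobInner X Y := by
  rw [frobInner_eq_sum, frobInner_eq_sum, Finset.sum_comm]
  rfl

theorem abs_frobInner_le (X Y : Matrix (Fin n) (Fin n) ℝ) :
    |frobInner X Y| ≤ ‖X‖ * ‖Y‖ := by
  refine abs_le_of_sq_le_sq ?_ (by positivity)
  rw [mul_pow, norm_sq_eq_sum, norm_sq_eq_sum, frobInner_eq_sum]
  simp only [← Finset.sum_product']
  exact Finset.sum_mul_sq_le_sq_mul_sq _ (fun p : Fin n × Fin n => X p.1 p.2) _

theorem abs_entry_le_norm (X : Matrix (Fin n) (Fin n) ℝ) (a b : Fin n) : |X a b| ≤ ‖X‖ := by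
  refine abs_le_of_sq_le_sq ?_ (norm_nonneg _)
  rw [norm_sq_eq_sum]
  calc X a b ^ 2 ≤ ∑ b, X a b ^ 2 :=
        Finset.single_le_sum (f := fun b => X a b ^ 2) (fun _ _ => sq_nonneg _) (Finset.mem_univ b)
    _ ≤ _ := Finset.single_le_sum (f := fun a => ∑ b, X a b ^ 2)
        (fun _ _ => Finset.sum_nonneg fun _ _ => sq_nonneg _) (Finset.mem_univ a)

theorem norm_orthogonal_mul {Q : Matrix (Fin n) (Fin n) ℝ} (hQ : Qᵀ * Q = 1)
    (X : Matrix (Fin n) (Fin n) ℝ) : ‖Q * X‖ = ‖X‖ := by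
  have h : ‖Q * X‖ ^ 2 = ‖X‖ ^ 2 := by
    rw [← frobInner_self, ← frobInner_self, frobInner_mul_right, ← Matrix.mul_assoc, hQ,
      Matrix.one_mul]
  exact (sq_eq_sq₀ (norm_nonneg _) (norm_nonneg _)).1 h

theorem norm_mul_orthogonal {Q : Matrix (Fin n) (Fin n) ℝ} (hQ : Q * Qᵀ = 1)
    (X : Matrix (Fin n) (Fin n) ℝ) : ‖X * Q‖ = ‖X‖ := by
  rw [← Matrix.frobenius_norm_transpose, Matrix.transpose_mul, norm_orthogonal_mul (by simpa),
    Matrix.frobenius_norm_transpose]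

end Frobenius

section Skew

variable {n : ℕ}

theorem sk_add (X Y : Matrix (Fin n) (Fin n) ℝ) : sk (X + Y) = sk X + sk Y := by
  simp only [sk, Matrix.transpose_add, ← smul_add]
  congr 1
  abel

theorem sk_sub (X Y : Matrix (Fin n) (Fin n) ℝ) : sk (X - Y) = sk X - sk Y := by
  simp only [sk, Matrix.transpose_sub, ← smul_sub]
  congr 1
  abel

theorem sk_smul (c : ℝ) (X : Matrix (Fin n) (Fin n) ℝ) : sk (c • X) = c • sk X := by
  simp only [sk, Matrix.transpose_smul, ← smul_sub]
  rw [smul_comm]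

theorem sk_transpose (X : Matrix (Fin n) (Fin n) ℝ) : sk Xᵀ = -sk X := by
  simp only [sk, Matrix.transpose_transpose, ← smul_neg, neg_sub]

theorem transpose_sk (X : Matrix (Fin n) (Fin n) ℝ) : (sk X)ᵀ = -sk X := by
  simp only [sk, Matrix.transpose_smul, Matrix.transpose_sub, Matrix.transpose_transpose,
    ← smul_neg, neg_sub]

theorem sk_eq_zero_of_symm {X : Matrix (Fin n) (Fin n) ℝ} (h : Xᵀ = X) : sk X = 0 := by
  simp [sk, h]

theorem sk_of_skew {X : Matrix (Fin n) (Fin n) ℝ} (h : Xᵀ = -X) : sk X = X := by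
  rw [sk, h, sub_neg_eq_add, ← two_smul ℝ X, smul_smul]
  norm_num

theorem frobInner_sk_right (X Y : Matrix (Fin n) (Fin n) ℝ) :
    frobInner X (sk Y) = frobInner (sk X) Y := by
  rw [sk, sk, frobInner_smul_left, frobInner_smul_right, frobInner_sub_left, frobInner_sub_right,
    ← frobInner_transpose X Yᵀ, Matrix.transpose_transpose]

theorem frobInner_skew_right {Z : Matrix (Fin n) (Fin n) ℝ} (hZ : Zᵀ = -Z)
    (X : Matrix (Fin n) (Fin n) ℝ) : frobInner X Z = frobInner (sk X) Z := by
  rw [← frobInner_sk_right, sk_of_skew hZ]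

theorem norm_sk_le (X : Matrix (Fin n) (Fin n) ℝ) : ‖sk X‖ ≤ ‖X‖ := by
  rw [sk, norm_smul]
  have h := norm_sub_le X Xᵀ
  rw [Matrix.frobenius_norm_transpose] at h
  norm_num
  linarith

end Skew

section Rotations

variable {n : ℕ}

theorem SO.transpose_mul_self (Q : SO n) :
    (Q : Matrix (Fin n) (Fin n) ℝ)ᵀ * (Q : Matrix (Fin n) (Fin n) ℝ) = 1 :=
  (Matrix.mem_orthogonalGroup_iff' _ _).1 (Matrix.mem_specialOrthogonalGroup_iff.1 Q.2).1

theorem SO.mul_transpose_self (Q : SO n) :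
    (Q : Matrix (Fin n) (Fin n) ℝ) * (Q : Matrix (Fin n) (Fin n) ℝ)ᵀ = 1 :=
  (Matrix.mem_orthogonalGroup_iff _ _).1 (Matrix.mem_specialOrthogonalGroup_iff.1 Q.2).1

theorem SO.det_eq_one (Q : SO n) : (Q : Matrix (Fin n) (Fin n) ℝ).det = 1 :=
  (Matrix.mem_specialOrthogonalGroup_iff.1 Q.2).2

theorem SO.norm_mul (Q : SO n) (X : Matrix (Fin n) (Fin n) ℝ) :
    ‖(Q : Matrix (Fin n) (Fin n) ℝ) * X‖ = ‖X‖ :=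
  norm_orthogonal_mul (SO.transpose_mul_self Q) X

theorem SO.norm_mul_right (Q : SO n) (X : Matrix (Fin n) (Fin n) ℝ) :
    ‖X * (Q : Matrix (Fin n) (Fin n) ℝ)‖ = ‖X‖ :=
  norm_mul_orthogonal (SO.mul_transpose_self Q) X

theorem SO.norm_mul_transpose (Q : SO n) (X : Matrix (Fin n) (Fin n) ℝ) :
    ‖X * (Q : Matrix (Fin n) (Fin n) ℝ)ᵀ‖ = ‖X‖ :=
  norm_mul_orthogonal (by simpa using SO.transpose_mul_self Q) X

theorem SO.abs_entry_le_one (Q : SO n) (a b : Fin n) :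
    |(Q : Matrix (Fin n) (Fin n) ℝ) a b| ≤ 1 := by
  have h := congrFun (congrFun (SO.mul_transpose_self Q) a) a
  rw [Matrix.mul_apply, Matrix.one_apply_eq] at h
  simp only [Matrix.transpose_apply, ← sq] at h
  have := Finset.single_le_sum (f := fun b => (Q : Matrix (Fin n) (Fin n) ℝ) a b ^ 2)
    (fun _ _ => sq_nonneg _) (Finset.mem_univ b)
  rw [← sq_le_one_iff_abs_le_one]
  linarith

end Rotations

section Projector

variable {n : ℕ}

theorem transpose_proj (y : EuclideanSpace ℝ (Fin n)) : (proj y)ᵀ = proj y := by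
  ext a b
  simp [proj, mul_comm]

theorem norm_proj (y : EuclideanSpace ℝ (Fin n)) : ‖proj y‖ = ‖y‖ ^ 2 := by
  refine (sq_eq_sq₀ (norm_nonneg _) (by positivity)).1 ?_
  rw [norm_sq_eq_sum, EuclideanSpace.real_norm_sq_eq, sq, Finset.sum_mul_sum]
  simp [proj, mul_pow]

theorem proj_mul_self {y : EuclideanSpace ℝ (Fin n)} (hy : ‖y‖ = 1) :
    proj y * proj y = proj y := by
  have h := EuclideanSpace.real_norm_sq_eq y
  rw [hy] at h
  ext a b
  calc ∑ c, y a * y c * (y c * y b) = (∑ c, y c ^ 2) * (y a * y b) := by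
        rw [Finset.sum_mul]
        exact Finset.sum_congr rfl fun c _ => by ring
    _ = y a * y b := by rw [← h]; ring

theorem proj_mul_eq_zero_iff {y : EuclideanSpace ℝ (Fin n)} (hy : ‖y‖ = 1)
    (X : Matrix (Fin n) (Fin n) ℝ) : proj y * X = 0 ↔ Xᵀ *ᵥ y.ofLp = 0 := by
  have key : proj y * X = Matrix.vecMulVec y.ofLp (Xᵀ *ᵥ y.ofLp) := by
    ext a b
    simp only [proj, Matrix.mul_apply, Matrix.of_apply, Matrix.vecMulVec_apply, Matrix.mulVec,
      dotProduct, Matrix.transpose_apply, Finset.mul_sum]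
    exact Finset.sum_congr rfl fun c _ => by ring
  rw [key]
  constructor
  · intro h
    have hne : ∃ a, y a ≠ 0 := by
      by_contra! hall
      have : y = 0 := by
        ext a
        exact hall a
      simp [this] at hy
    obtain ⟨a, ha⟩ := hne
    ext b
    have := congrFun (congrFun h a) b
    rw [Matrix.vecMulVec_apply] at this
    exact (mul_eq_zero.1 this).resolve_left ha
  · intro h
    rw [h]
    ext a b
    simp [Matrix.vecMulVec_apply]

end Projector

end PartialSync
end

noncomputable section
namespace PartialSync

attribute [local instance] Matrix.frobeniusNormedAddCommGroup Matrix.frobeniusNormedSpace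

/-! ### The two functionals and their derivatives along the flow -/

section Functionals

variable {k n : ℕ}

/-- The sum of the squared distances between all ordered pairs of agents. -/
def spread (Q : State k n) : ℝ := ∑ i, ∑ j, ‖(Q i).1 - (Q j).1‖ ^ 2

/-- The output disagreement, summed over all oriented edges. -/
def edgeEnergy (G : SimpleGraph (Fin k)) [DecidableRel G.Adj]
    (y : Fin k → Fin k → EuclideanSpace ℝ (Fin n)) (Q : State k n) : ℝ :=
  ∑ i, ∑ j ∈ G.neighborFinset i, ‖proj (y i j) * ((Q i).1 - (Q j).1)‖ ^ 2

/-- The body velocity of agent `i` under the coupling law. -/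
def bodyVelocity (G : SimpleGraph (Fin k)) [DecidableRel G.Adj]
    (y : Fin k → Fin k → EuclideanSpace ℝ (Fin n)) (Q : State k n) (i : Fin k) :
    Matrix (Fin n) (Fin n) ℝ :=
  ∑ j ∈ G.neighborFinset i, sk ((Q i).1ᵀ * proj (y i j) * (Q j).1)

theorem spread_nonneg (Q : State k n) : 0 ≤ spread Q :=
  Finset.sum_nonneg fun _ _ => Finset.sum_nonneg fun _ _ => sq_nonneg _

theorem norm_sub_sq_le_spread (Q : State k n) (i j : Fin k) :
    ‖(Q i).1 - (Q j).1‖ ^ 2 ≤ spread Q :=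
  (Finset.single_le_sum (f := fun j => ‖(Q i).1 - (Q j).1‖ ^ 2) (fun _ _ => sq_nonneg _)
    (Finset.mem_univ j)).trans
  (Finset.single_le_sum (f := fun i => ∑ j, ‖(Q i).1 - (Q j).1‖ ^ 2)
    (fun _ _ => Finset.sum_nonneg fun _ _ => sq_nonneg _) (Finset.mem_univ i))

theorem norm_sub_le_sqrt_spread (Q : State k n) (i j : Fin k) :
    ‖(Q i).1 - (Q j).1‖ ≤ √(spread Q) :=
  Real.le_sqrt_of_sq_le (norm_sub_sq_le_spread Q i j)

theorem spread_eq_zero_iff (Q : State k n) : spread Q = 0 ↔ Q ∈ stateSync k n := by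
  constructor
  · intro h i j
    have h1 := norm_sub_sq_le_spread Q i j
    rw [h] at h1
    have h2 : ‖(Q i).1 - (Q j).1‖ = 0 := by
      have := norm_nonneg ((Q i).1 - (Q j).1)
      nlinarith
    exact Subtype.ext (sub_eq_zero.1 (norm_eq_zero.1 h2))
  · intro h
    refine Finset.sum_eq_zero fun i _ => Finset.sum_eq_zero fun j _ => ?_
    rw [h i j, sub_self, norm_zero]
    norm_num

variable {G : SimpleGraph (Fin k)} [DecidableRel G.Adj]
  {y : Fin k → Fin k → EuclideanSpace ℝ (Fin n)}

theorem sum_neighbors_comm (g : Fin k → Fin k → ℝ) :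
    ∑ i, ∑ j ∈ G.neighborFinset i, g i j = ∑ i, ∑ j ∈ G.neighborFinset i, g j i := by
  refine Finset.sum_comm' fun i j => ?_
  simp [SimpleGraph.adj_comm]

theorem edgeEnergy_nonneg (Q : State k n) : 0 ≤ edgeEnergy G y Q :=
  Finset.sum_nonneg fun _ _ => Finset.sum_nonneg fun _ _ => sq_nonneg _

theorem couplingField_eq (Q : State k n) (i : Fin k) :
    couplingField G y Q i = (Q i).1 * bodyVelocity G y Q i := rfl

theorem transpose_bodyVelocity (Q : State k n) (i : Fin k) :
    (bodyVelocity G y Q i)ᵀ = -bodyVelocity G y Q i := by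
  simp only [bodyVelocity, Matrix.transpose_sum, transpose_sk, Finset.sum_neg_distrib]

end Functionals

section Edge

variable {n : ℕ} {M : Matrix (Fin n) (Fin n) ℝ}

/-- `Rᵀ M R` is symmetric and drops out of the skew part. Every edge term is thus of first order in
`P - R`. -/
theorem sk_transpose_mul_mul (hM : Mᵀ = M) (P R : Matrix (Fin n) (Fin n) ℝ) :
    sk (Pᵀ * M * R) = sk ((P - R)ᵀ * M * R) := by
  have h : sk (Rᵀ * M * R) = 0 :=
    sk_eq_zero_of_symm (by
      rw [Matrix.transpose_mul, Matrix.transpose_mul, Matrix.transpose_transpose, hM,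
        Matrix.mul_assoc])
  rw [Matrix.transpose_sub, Matrix.sub_mul, Matrix.sub_mul, sk_sub, h, sub_zero]

/-- Near `R` the rotation group moves in skew directions: `(P - R)ᵀ R` is skew up to an exact
quadratic correction. -/
theorem sk_sub_transpose_mul (P R : SO n) :
    sk ((P.1 - R.1)ᵀ * R.1) =
      (P.1 - R.1)ᵀ * R.1 + (1 / 2 : ℝ) • ((P.1 - R.1)ᵀ * (P.1 - R.1)) := by
  have h1 := SO.transpose_mul_self P
  have h2 := SO.transpose_mul_self R
  simp only [sk, Matrix.transpose_sub, Matrix.transpose_mul, Matrix.transpose_transpose,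
    Matrix.transpose_one, Matrix.sub_mul, Matrix.mul_sub, h1, h2]
  module

theorem frobInner_sub_transpose_mul (hM : Mᵀ = M) (hMM : M * M = M) (R : SO n)
    (D : Matrix (Fin n) (Fin n) ℝ) :
    frobInner (Dᵀ * R.1) (Dᵀ * M * R.1) = ‖M * D‖ ^ 2 := by
  rw [frobInner_mul_right', Matrix.mul_assoc, SO.mul_transpose_self, Matrix.mul_one,
    ← frobInner_transpose, Matrix.transpose_transpose, Matrix.transpose_mul,
    Matrix.transpose_transpose, hM]
  conv_lhs => rw [← hMM, Matrix.mul_assoc, frobInner_mul_right, hM]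
  rw [frobInner_self]

theorem norm_transpose_mul_mul_le (hM : Mᵀ = M) (R : SO n) (D : Matrix (Fin n) (Fin n) ℝ) :
    ‖Dᵀ * M * R.1‖ = ‖M * D‖ := by
  rw [SO.norm_mul_right, ← Matrix.frobenius_norm_transpose, Matrix.transpose_mul,
    Matrix.transpose_transpose, hM]

/-- For use with `N` the sum of all agents and `c = k`. Replacing `N` by `c R` and `(P - R)ᵀ R` by
its skew part leaves exactly `c ‖M (P - R)‖²`; the two errors, from curvature and from `N - c R`,
are cubic near synchronization. -/
theorem abs_frobInner_edge_sub_le (hM : Mᵀ = M) (hMM : M * M = M) (hM1 : ‖M‖ ≤ 1) (P R : SO n)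
    (N : Matrix (Fin n) (Fin n) ℝ) {c : ℝ} (hc : 0 ≤ c) :
    |frobInner ((P.1 - R.1)ᵀ * N) (sk (P.1ᵀ * M * R.1)) - c * ‖M * (P.1 - R.1)‖ ^ 2| ≤
      (c / 2 * ‖P.1 - R.1‖ ^ 2 + ‖P.1 - R.1‖ * ‖N - c • R.1‖) * ‖P.1 - R.1‖ := by
  set D := P.1 - R.1 with hD
  have hN : Dᵀ * N = c • (Dᵀ * R.1) + Dᵀ * (N - c • R.1) := by
    rw [Matrix.mul_sub, Matrix.mul_smul]
    abel
  have hsk : sk (Dᵀ * N) =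
      c • (Dᵀ * R.1) + ((c / 2) • (Dᵀ * D) + sk (Dᵀ * (N - c • R.1))) := by
    rw [hN, sk_add, sk_smul, hD, sk_sub_transpose_mul, smul_add, smul_smul, add_assoc]
    ring_nf
  have hle : ‖M * D‖ ≤ ‖D‖ :=
    (Matrix.frobenius_norm_mul _ _).trans (mul_le_of_le_one_left (norm_nonneg _) hM1)
  rw [sk_transpose_mul_mul hM, frobInner_sk_right, hsk, frobInner_add_left, frobInner_smul_left,
    frobInner_sub_transpose_mul hM hMM, add_sub_cancel_left]
  refine (abs_frobInner_le _ _).trans ?_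
  rw [norm_transpose_mul_mul_le hM]
  refine mul_le_mul ?_ hle (norm_nonneg _) (by positivity)
  refine (norm_add_le _ _).trans (add_le_add ?_ ?_)
  · rw [norm_smul, Real.norm_of_nonneg (by positivity), sq]
    refine mul_le_mul_of_nonneg_left ?_ (by positivity)
    simpa [Matrix.frobenius_norm_transpose] using Matrix.frobenius_norm_mul Dᵀ D
  · refine (norm_sk_le _).trans ?_
    simpa [Matrix.frobenius_norm_transpose] using Matrix.frobenius_norm_mul Dᵀ (N - c • R.1)

end Edge

section Rates

variable {k n : ℕ} {G : SimpleGraph (Fin k)} [DecidableRel G.Adj]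
  {y : Fin k → Fin k → EuclideanSpace ℝ (Fin n)}

/-- The rate of change of `spread` along the coupling law. -/
def spreadRate (G : SimpleGraph (Fin k)) [DecidableRel G.Adj]
    (y : Fin k → Fin k → EuclideanSpace ℝ (Fin n)) (Q : State k n) : ℝ :=
  ∑ i, ∑ j, 2 * frobInner ((Q i).1 - (Q j).1) (couplingField G y Q i - couplingField G y Q j)

/-- The pairings of `Q_i` with its own velocity vanish, since the identity is orthogonal to skew
matrices; what remains is the pairing of the sum of all agents with the total field. Edge terms
change sign when the endpoints are swapped, which produces the differences. -/
theorem spreadRate_eq (hy : IsReference G y) (Q : State k n) :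
    spreadRate G y Q = -2 * ∑ i, ∑ j ∈ G.neighborFinset i,
      frobInner (((Q i).1 - (Q j).1)ᵀ * ∑ l, (Q l).1)
        (sk ((Q i).1ᵀ * proj (y i j) * (Q j).1)) := by
  set N := ∑ l, (Q l).1 with hN
  have hself : ∀ i, frobInner (Q i).1 (couplingField G y Q i) = 0 := fun i => by
    rw [couplingField_eq, frobInner_mul_right, SO.transpose_mul_self,
      frobInner_skew_right (transpose_bodyVelocity Q i), sk_eq_zero_of_symm Matrix.transpose_one]
    simp [frobInner]
  have h1 : spreadRate G y Q = -4 * ∑ i, frobInner N (couplingField G y Q i) := by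
    have hexp : ∀ i j, 2 * frobInner ((Q i).1 - (Q j).1)
        (couplingField G y Q i - couplingField G y Q j) =
        -2 * frobInner (Q i).1 (couplingField G y Q j) -
          2 * frobInner (Q j).1 (couplingField G y Q i) := fun i j => by
      rw [frobInner_sub_left, frobInner_sub_right, frobInner_sub_right, hself, hself]
      ring
    have h2 : ∑ i, ∑ j, frobInner (Q i).1 (couplingField G y Q j) =
        ∑ i, frobInner N (couplingField G y Q i) := by
      rw [Finset.sum_comm]
      exact Finset.sum_congr rfl fun j _ => (frobInner_sum_left _ _ _).symm
    have h3 : ∑ i, ∑ j, frobInner (Q j).1 (couplingField G y Q i) =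
        ∑ i, frobInner N (couplingField G y Q i) :=
      Finset.sum_congr rfl fun j _ => (frobInner_sum_left _ _ _).symm
    simp only [spreadRate, hexp, Finset.sum_sub_distrib, ← Finset.mul_sum, h2, h3]
    ring
  have h2 : ∑ i, frobInner N (couplingField G y Q i) = ∑ i, ∑ j ∈ G.neighborFinset i,
      frobInner ((Q i).1ᵀ * N) (sk ((Q i).1ᵀ * proj (y i j) * (Q j).1)) :=
    Finset.sum_congr rfl fun i _ => by
      rw [couplingField_eq, frobInner_mul_right, bodyVelocity, frobInner_sum_right]
  have h3 : ∑ i, ∑ j ∈ G.neighborFinset i,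
      frobInner ((Q i).1ᵀ * N) (sk ((Q i).1ᵀ * proj (y i j) * (Q j).1)) =
      -∑ i, ∑ j ∈ G.neighborFinset i,
      frobInner ((Q j).1ᵀ * N) (sk ((Q i).1ᵀ * proj (y i j) * (Q j).1)) := by
    rw [sum_neighbors_comm]
    simp only [← Finset.sum_neg_distrib]
    refine Finset.sum_congr rfl fun i _ => Finset.sum_congr rfl fun j hj => ?_
    rw [← frobInner_neg_right, ← sk_transpose, hy.symm i j (by simpa using hj)]
    simp [Matrix.transpose_mul, transpose_proj, Matrix.mul_assoc]
  have h4 : ∀ i j, frobInner (((Q i).1 - (Q j).1)ᵀ * N)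
      (sk ((Q i).1ᵀ * proj (y i j) * (Q j).1)) =
      frobInner ((Q i).1ᵀ * N) (sk ((Q i).1ᵀ * proj (y i j) * (Q j).1)) -
      frobInner ((Q j).1ᵀ * N) (sk ((Q i).1ᵀ * proj (y i j) * (Q j).1)) := fun i j => by
    rw [Matrix.transpose_sub, Matrix.sub_mul, frobInner_sub_left]
  rw [h1, h2]
  simp only [h4, Finset.sum_sub_distrib]
  linarith

theorem spreadRate_le (hy : IsReference G y) (Q : State k n) :
    spreadRate G y Q ≤
      -2 * k * edgeEnergy G y Q + 3 * k ^ 3 * (√(spread Q)) ^ 3 := by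
  set s := √(spread Q) with hs
  have hs0 : 0 ≤ s := Real.sqrt_nonneg _
  have hk : (0 : ℝ) ≤ k := Nat.cast_nonneg k
  -- With `s = √V` the error per oriented edge is `(k/2 + k) s³`. There are at most `k²` oriented
  -- edges, and the prefactor `2` makes `3 k³ s³`.
  have hedge : ∀ i, ∀ j ∈ G.neighborFinset i,
      k * ‖proj (y i j) * ((Q i).1 - (Q j).1)‖ ^ 2 - 3 / 2 * k * s ^ 3 ≤
      frobInner (((Q i).1 - (Q j).1)ᵀ * ∑ l, (Q l).1)
        (sk ((Q i).1ᵀ * proj (y i j) * (Q j).1)) := by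
    intro i j hj
    have hu : ‖y i j‖ = 1 := hy.unit i j (by simpa using hj)
    have h := abs_frobInner_edge_sub_le (transpose_proj (y i j)) (proj_mul_self hu)
      (by rw [norm_proj, hu]; norm_num) (Q i) (Q j) (∑ l, (Q l).1) hk
    have hN : ‖∑ l, (Q l).1 - (k : ℝ) • (Q j).1‖ ≤ k * s := by
      have : ∑ l, (Q l).1 - (k : ℝ) • (Q j).1 = ∑ l, ((Q l).1 - (Q j).1) := by
        simp [Finset.sum_sub_distrib, Nat.cast_smul_eq_nsmul]
      rw [this]
      refine (norm_sum_le _ _).trans ?_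
      refine (Finset.sum_le_sum fun l _ => norm_sub_le_sqrt_spread Q l j).trans ?_
      simp [hs]
    have hD := norm_sub_le_sqrt_spread Q i j
    rw [← hs] at hD
    have h2 : ((k : ℝ) / 2 * ‖(Q i).1 - (Q j).1‖ ^ 2 + ‖(Q i).1 - (Q j).1‖ *
        ‖∑ l, (Q l).1 - (k : ℝ) • (Q j).1‖) * ‖(Q i).1 - (Q j).1‖ ≤
        ((k : ℝ) / 2 * s ^ 2 + s * (k * s)) * s := by gcongr
    have h3 := (abs_le.1 (h.trans h2)).1
    nlinarith
  have hsum : k * edgeEnergy G y Q - 3 / 2 * k ^ 3 * s ^ 3 ≤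
      ∑ i, ∑ j ∈ G.neighborFinset i, frobInner (((Q i).1 - (Q j).1)ᵀ * ∑ l, (Q l).1)
        (sk ((Q i).1ᵀ * proj (y i j) * (Q j).1)) := by
    calc k * edgeEnergy G y Q - 3 / 2 * k ^ 3 * s ^ 3
        ≤ ∑ i, ∑ j ∈ G.neighborFinset i,
          (k * ‖proj (y i j) * ((Q i).1 - (Q j).1)‖ ^ 2 - 3 / 2 * k * s ^ 3) := by
          simp only [Finset.sum_sub_distrib, edgeEnergy, Finset.mul_sum]
          refine sub_le_sub_left ?_ _
          have h1 : ∀ i, ∑ _j ∈ G.neighborFinset i, (3 / 2 * k * s ^ 3) ≤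
              k * (3 / 2 * k * s ^ 3) := fun i => by
            rw [Finset.sum_const, nsmul_eq_mul]
            refine mul_le_mul_of_nonneg_right ?_ (by positivity)
            exact_mod_cast (Finset.card_le_univ _).trans (by simp)
          refine (Finset.sum_le_sum fun i _ => h1 i).trans (le_of_eq ?_)
          simp
          ring
      _ ≤ _ := Finset.sum_le_sum fun i _ => Finset.sum_le_sum fun j hj => hedge i j hj
  rw [spreadRate_eq hy]
  linarith

theorem norm_bodyVelocity_le (Q : State k n) (i : Fin k) :
    ‖bodyVelocity G y Q i‖ ≤ k * √(edgeEnergy G y Q) := by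
  refine (norm_sum_le _ _).trans ?_
  have h : ∀ j ∈ G.neighborFinset i,
      ‖sk ((Q i).1ᵀ * proj (y i j) * (Q j).1)‖ ≤ √(edgeEnergy G y Q) := fun j hj => by
    rw [sk_transpose_mul_mul (transpose_proj _)]
    refine (norm_sk_le _).trans ?_
    rw [norm_transpose_mul_mul_le (transpose_proj _)]
    refine Real.le_sqrt_of_sq_le ?_
    exact (Finset.single_le_sum (f := fun j => ‖proj (y i j) * ((Q i).1 - (Q j).1)‖ ^ 2)
      (fun _ _ => sq_nonneg _) hj).trans
      (Finset.single_le_sum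
        (f := fun i => ∑ j ∈ G.neighborFinset i, ‖proj (y i j) * ((Q i).1 - (Q j).1)‖ ^ 2)
        (fun _ _ => Finset.sum_nonneg fun _ _ => sq_nonneg _) (Finset.mem_univ i))
  refine (Finset.sum_le_sum h).trans ?_
  rw [Finset.sum_const, nsmul_eq_mul]
  refine mul_le_mul_of_nonneg_right ?_ (Real.sqrt_nonneg _)
  exact_mod_cast (Finset.card_le_univ _).trans (by simp)

/-- The gradient-flow identity for the output disagreement. Since `M` is a symmetric idempotent,
each edge reduces to pairings of `M Q_b` with the velocity of `Q_a`; those with `a = b` vanish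
because `Q_aᵀ M Q_a` is symmetric. -/
theorem edgeEnergy_rate_eq (hy : IsReference G y) (Q : State k n) :
    ∑ i, ∑ j ∈ G.neighborFinset i, 2 * frobInner (proj (y i j) * ((Q i).1 - (Q j).1))
      (proj (y i j) * (couplingField G y Q i - couplingField G y Q j)) =
    -4 * ∑ i, ‖bodyVelocity G y Q i‖ ^ 2 := by
  have hterm : ∀ i, ∀ j ∈ G.neighborFinset i,
      2 * frobInner (proj (y i j) * ((Q i).1 - (Q j).1))
        (proj (y i j) * (couplingField G y Q i - couplingField G y Q j)) =
      -2 * frobInner (sk ((Q i).1ᵀ * proj (y i j) * (Q j).1)) (bodyVelocity G y Q i) +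
      -2 * frobInner (sk ((Q j).1ᵀ * proj (y j i) * (Q i).1)) (bodyVelocity G y Q j) := by
    intro i j hj
    have hadj : G.Adj i j := by simpa using hj
    have hM := transpose_proj (y i j)
    have hMM := proj_mul_self (hy.unit i j hadj)
    have hred : ∀ a b : Fin k, frobInner (proj (y i j) * (Q b).1) (couplingField G y Q a) =
        frobInner (sk ((Q a).1ᵀ * proj (y i j) * (Q b).1)) (bodyVelocity G y Q a) :=
      fun a b => by
        rw [couplingField_eq, frobInner_mul_right,
          frobInner_skew_right (transpose_bodyVelocity Q a), Matrix.mul_assoc]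
    have hdiag : ∀ a : Fin k, frobInner (proj (y i j) * (Q a).1) (couplingField G y Q a) = 0 :=
      fun a => by
        rw [hred, sk_eq_zero_of_symm]
        · simp [frobInner]
        · rw [Matrix.transpose_mul, Matrix.transpose_mul, Matrix.transpose_transpose, hM,
            Matrix.mul_assoc]
    rw [frobInner_mul_right, hM, ← Matrix.mul_assoc, hMM, Matrix.mul_sub, frobInner_sub_left,
      frobInner_sub_right, frobInner_sub_right, hdiag, hdiag, hred, hred, ← hy.symm i j hadj]
    ring
  rw [Finset.sum_congr rfl fun i _ => Finset.sum_congr rfl fun j hj => hterm i j hj]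
  simp only [Finset.sum_add_distrib]
  rw [← sum_neighbors_comm (fun i j =>
    -2 * frobInner (sk ((Q i).1ᵀ * proj (y i j) * (Q j).1)) (bodyVelocity G y Q i))]
  have : ∀ i, ∑ j ∈ G.neighborFinset i,
      -2 * frobInner (sk ((Q i).1ᵀ * proj (y i j) * (Q j).1)) (bodyVelocity G y Q i) =
      -2 * ‖bodyVelocity G y Q i‖ ^ 2 := fun i => by
    rw [← Finset.mul_sum, ← frobInner_sum_left, ← frobInner_self]
    rfl
  simp only [this, ← Finset.mul_sum]
  ring

end Rates

section Trajectories

variable {k n : ℕ} {G : SimpleGraph (Fin k)} [DecidableRel G.Adj]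
  {y : Fin k → Fin k → EuclideanSpace ℝ (Fin n)}

theorem hasDerivWithinAt_norm_sq {A : ℝ → Matrix (Fin n) (Fin n) ℝ}
    {A' : Matrix (Fin n) (Fin n) ℝ} {s : Set ℝ} {t : ℝ}
    (h : ∀ a b, HasDerivWithinAt (fun u => A u a b) (A' a b) s t) :
    HasDerivWithinAt (fun u => ‖A u‖ ^ 2) (2 * frobInner (A t) A') s t := by
  have heq : (fun u => ‖A u‖ ^ 2) = fun u => ∑ a, ∑ b, A u a b ^ 2 :=
    funext fun u => norm_sq_eq_sum (A u)
  rw [heq, frobInner_eq_sum]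
  simp only [Finset.mul_sum]
  refine HasDerivWithinAt.fun_sum fun a _ => HasDerivWithinAt.fun_sum fun b _ => ?_
  refine ((h a b).fun_pow 2).congr_deriv ?_
  push_cast
  ring

theorem hasDerivWithinAt_mul_entry (B : Matrix (Fin n) (Fin n) ℝ)
    {A : ℝ → Matrix (Fin n) (Fin n) ℝ} {A' : Matrix (Fin n) (Fin n) ℝ} {s : Set ℝ} {t : ℝ}
    (h : ∀ a b, HasDerivWithinAt (fun u => A u a b) (A' a b) s t) (a b : Fin n) :
    HasDerivWithinAt (fun u => (B * A u) a b) ((B * A') a b) s t := by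
  simp only [Matrix.mul_apply]
  exact HasDerivWithinAt.fun_sum fun c _ => (h c b).const_mul _

theorem IsSolution.hasDerivWithinAt_spread {Q : ℝ → State k n} (hQ : IsSolution G y Q) {t : ℝ}
    (ht : 0 ≤ t) :
    HasDerivWithinAt (fun u => spread (Q u)) (spreadRate G y (Q t)) (Set.Ici 0) t := by
  refine HasDerivWithinAt.fun_sum fun i _ => HasDerivWithinAt.fun_sum fun j _ => ?_
  exact hasDerivWithinAt_norm_sq (A := fun u => (Q u i).1 - (Q u j).1)
    fun a b => (hQ t ht i a b).sub (hQ t ht j a b)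

theorem IsSolution.hasDerivWithinAt_edgeEnergy (hy : IsReference G y) {Q : ℝ → State k n}
    (hQ : IsSolution G y Q) {t : ℝ} (ht : 0 ≤ t) :
    HasDerivWithinAt (fun u => edgeEnergy G y (Q u))
      (-4 * ∑ i, ‖bodyVelocity G y (Q t) i‖ ^ 2) (Set.Ici 0) t := by
  rw [← edgeEnergy_rate_eq hy]
  refine HasDerivWithinAt.fun_sum fun i _ => HasDerivWithinAt.fun_sum fun j _ => ?_
  exact hasDerivWithinAt_norm_sq (A := fun u => proj (y i j) * ((Q u i).1 - (Q u j).1))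
    (hasDerivWithinAt_mul_entry _ fun a b => (hQ t ht i a b).sub (hQ t ht j a b))

theorem IsSolution.continuousOn_spread {Q : ℝ → State k n} (hQ : IsSolution G y Q) :
    ContinuousOn (fun u => spread (Q u)) (Set.Ici 0) :=
  fun _ ht => (hQ.hasDerivWithinAt_spread ht).continuousWithinAt

theorem IsSolution.antitoneOn_edgeEnergy (hy : IsReference G y) {Q : ℝ → State k n}
    (hQ : IsSolution G y Q) : AntitoneOn (fun u => edgeEnergy G y (Q u)) (Set.Ici 0) := by
  refine antitoneOn_of_hasDerivWithinAt_nonpos (convex_Ici 0)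
    (f' := fun t => -4 * ∑ i, ‖bodyVelocity G y (Q t) i‖ ^ 2)
    (fun t ht => (hQ.hasDerivWithinAt_edgeEnergy hy ht).continuousWithinAt) ?_ ?_
  · intro t ht
    exact (hQ.hasDerivWithinAt_edgeEnergy hy (interior_subset ht)).mono interior_subset
  · intro t _
    have : 0 ≤ ∑ i, ‖bodyVelocity G y (Q t) i‖ ^ 2 := Finset.sum_nonneg fun _ _ => sq_nonneg _
    linarith

/-- A solution moves slowly while the output disagreement is small. -/
theorem IsSolution.abs_sub_entry_le (hy : IsReference G y) {Q : ℝ → State k n}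
    (hQ : IsSolution G y Q) {T : ℝ} (hT : 0 ≤ T) (i : Fin k) (a b : Fin n) :
    |(Q T i).1 a b - (Q 0 i).1 a b| ≤ k * √(edgeEnergy G y (Q 0)) * T := by
  have h := (convex_Ici (0 : ℝ)).norm_image_sub_le_of_norm_hasDerivWithin_le
    (f := fun s => (Q s i).1 a b) (C := k * √(edgeEnergy G y (Q 0)))
    (fun t ht => hQ t ht i a b) (fun t ht => ?_) (Set.self_mem_Ici (a := (0:ℝ))) hT
  · simpa [abs_of_nonneg hT] using h
  · rw [Real.norm_eq_abs]
    refine (abs_entry_le_norm _ a b).trans ?_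
    rw [couplingField_eq, SO.norm_mul]
    refine (norm_bodyVelocity_le _ _).trans ?_
    gcongr
    exact hQ.antitoneOn_edgeEnergy hy (Set.self_mem_Ici) ht ht

end Trajectories

end PartialSync
end

noncomputable section
namespace PartialSync

attribute [local instance] Matrix.frobeniusNormedAddCommGroup Matrix.frobeniusNormedSpace

/-! ### Comparison of `spread` with the distance to synchronization -/

section Distance

variable {k n : ℕ}

theorem norm_vecStack_sq (X : Fin k → Matrix (Fin n) (Fin n) ℝ) :
    ‖vecStack X‖ ^ 2 = ∑ i, ‖X i‖ ^ 2 := by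
  rw [EuclideanSpace.real_norm_sq_eq, Fintype.sum_prod_type, Finset.sum_comm,
    Fintype.sum_prod_type]
  refine Finset.sum_congr rfl fun i _ => ?_
  rw [norm_sq_eq_sum]
  rfl

theorem vecStack_sub (X Y : Fin k → Matrix (Fin n) (Fin n) ℝ) :
    vecStack X - vecStack Y = vecStack fun i => X i - Y i := rfl

theorem dist_stateVec_sq (Q P : State k n) :
    dist (stateVec Q) (stateVec P) ^ 2 = ∑ i, ‖(Q i).1 - (P i).1‖ ^ 2 := by
  rw [dist_eq_norm, stateVec, stateVec, vecStack_sub, norm_vecStack_sq]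

theorem norm_sub_le_dist_stateVec (Q P : State k n) (i : Fin k) :
    ‖(Q i).1 - (P i).1‖ ≤ dist (stateVec Q) (stateVec P) := by
  refine le_of_sq_le_sq ?_ dist_nonneg
  rw [dist_stateVec_sq]
  exact Finset.single_le_sum (f := fun i => ‖(Q i).1 - (P i).1‖ ^ 2) (fun _ _ => sq_nonneg _)
    (Finset.mem_univ i)

theorem distTo_nonneg (S : Set (State k n)) (Q : State k n) : 0 ≤ distTo S Q :=
  Metric.infDist_nonneg

theorem stateSync_nonempty : (stateVec '' stateSync k n).Nonempty :=
  ⟨_, ⟨fun _ => 1, fun _ _ => rfl, rfl⟩⟩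

theorem distTo_stateSync_le (hk : 1 ≤ k) (Q : State k n) :
    distTo (stateSync k n) Q ≤ √(spread Q) := by
  let i₀ : Fin k := ⟨0, hk⟩
  refine (Metric.infDist_le_dist_of_mem
    (Set.mem_image_of_mem stateVec (show (fun _ => Q i₀) ∈ stateSync k n from
      fun _ _ => rfl))).trans ?_
  refine Real.le_sqrt_of_sq_le ?_
  rw [dist_stateVec_sq, spread, Finset.sum_comm]
  exact Finset.single_le_sum (f := fun j => ∑ i, ‖(Q i).1 - (Q j).1‖ ^ 2)
    (fun _ _ => Finset.sum_nonneg fun _ _ => sq_nonneg _) (Finset.mem_univ i₀)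

theorem norm_sub_le_distTo (Q : State k n) (i j : Fin k) :
    ‖(Q i).1 - (Q j).1‖ ≤ 2 * distTo (stateSync k n) Q := by
  suffices h : ‖(Q i).1 - (Q j).1‖ / 2 ≤ distTo (stateSync k n) Q by linarith
  refine (Metric.le_infDist stateSync_nonempty).2 ?_
  rintro _ ⟨P, hP, rfl⟩
  have h1 := norm_sub_le_dist_stateVec Q P i
  have h2 := norm_sub_le_dist_stateVec Q P j
  have h3 : (Q i).1 - (Q j).1 = ((Q i).1 - (P i).1) - ((Q j).1 - (P j).1) := by
    rw [hP i j]
    abel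
  have h4 := norm_sub_le ((Q i).1 - (P i).1) ((Q j).1 - (P j).1)
  rw [h3]
  linarith

theorem spread_le_distTo (Q : State k n) :
    spread Q ≤ (2 * k * distTo (stateSync k n) Q) ^ 2 := by
  have h : ∀ i j, ‖(Q i).1 - (Q j).1‖ ^ 2 ≤ (2 * distTo (stateSync k n) Q) ^ 2 := fun i j =>
    pow_le_pow_left₀ (norm_nonneg _) (norm_sub_le_distTo Q i j) 2
  refine (Finset.sum_le_sum fun i _ => Finset.sum_le_sum fun j _ => h i j).trans (le_of_eq ?_)
  simp
  ring

theorem sqrt_spread_le_distTo (Q : State k n) :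
    √(spread Q) ≤ 2 * k * distTo (stateSync k n) Q := by
  refine Real.sqrt_le_iff.2 ⟨?_, spread_le_distTo Q⟩
  have := distTo_nonneg (stateSync k n) Q
  positivity

end Distance

/-! ### Infinitesimal rigidity and coercivity near synchronization -/

section Rigidity

variable {k n : ℕ}

/-- The only skew-symmetric first order motions that keep the outputs synchronized are the
common rotations. -/
def InfRigid (G : SimpleGraph (Fin k)) (y : Fin k → Fin k → EuclideanSpace ℝ (Fin n)) : Prop :=
  ∀ Ω : Fin k → Matrix (Fin n) (Fin n) ℝ, (∀ i, (Ω i)ᵀ = -Ω i) →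
    (∀ i j, G.Adj i j → proj (y i j) * (Ω i - Ω j) = 0) → ∀ i j, Ω i = Ω j

/-- If `ker T ≤ ker S` with finite-dimensional range spaces, then `S` is bounded by `T`. -/
theorem exists_norm_le_mul_norm_of_ker_le {E F H : Type*} [AddCommGroup E] [Module ℝ E]
    [NormedAddCommGroup F] [NormedSpace ℝ F] [FiniteDimensional ℝ F]
    [NormedAddCommGroup H] [NormedSpace ℝ H] (T : E →ₗ[ℝ] F) (S : E →ₗ[ℝ] H)
    (h : LinearMap.ker T ≤ LinearMap.ker S) :
    ∃ C, 0 ≤ C ∧ ∀ x, ‖S x‖ ≤ C * ‖T x‖ := by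
  -- `g` is a linear section of `T` over its range. As `x - g (T x)` lies in `ker T`, hence in `ker
  -- S`, the map `S` factors through the range of `T`, where finite dimension makes it bounded.
  obtain ⟨g, hg⟩ := T.rangeRestrict.exists_rightInverse_of_surjective T.range_rangeRestrict
  let L : LinearMap.range T →L[ℝ] H := LinearMap.toContinuousLinearMap (S ∘ₗ g)
  refine ⟨‖L‖, L.opNorm_nonneg, fun x => ?_⟩
  have hx : S x = L (T.rangeRestrict x) := by
    have h1 : x - g (T.rangeRestrict x) ∈ LinearMap.ker T := by
      have h2 : T.rangeRestrict (g (T.rangeRestrict x)) = T.rangeRestrict x :=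
        LinearMap.congr_fun hg _
      rw [LinearMap.mem_ker, map_sub, sub_eq_zero]
      exact (congrArg Subtype.val h2).symm
    have h3 := h h1
    rw [LinearMap.mem_ker, map_sub, sub_eq_zero] at h3
    exact h3
  rw [hx]
  exact L.le_opNorm _

/-- The skew-symmetric tuples of matrices. -/
def skewTuples (k n : ℕ) : Submodule ℝ (Fin k → Matrix (Fin n) (Fin n) ℝ) where
  carrier := {Ω | ∀ i, (Ω i)ᵀ = -Ω i}
  add_mem' {a b} ha hb i := by
    simp only [Pi.add_apply, Matrix.transpose_add, ha i, hb i]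
    abel
  zero_mem' i := by simp
  smul_mem' c a ha i := by simp [ha i]

/-- `S` records the differences over all pairs and `T` the projected differences over edges;
rigidity is precisely `ker T ≤ ker S`. -/
theorem InfRigid.exists_coercive {G : SimpleGraph (Fin k)} [DecidableRel G.Adj]
    {y : Fin k → Fin k → EuclideanSpace ℝ (Fin n)} (h : InfRigid G y) :
    ∃ C, 0 ≤ C ∧ ∀ Ω : Fin k → Matrix (Fin n) (Fin n) ℝ, (∀ i, (Ω i)ᵀ = -Ω i) →
      ∑ i, ∑ j, ‖Ω i - Ω j‖ ^ 2 ≤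
        C * ∑ i, ∑ j ∈ G.neighborFinset i, ‖proj (y i j) * (Ω i - Ω j)‖ ^ 2 := by
  let S : skewTuples k n →ₗ[ℝ] (Fin k → Fin k → Matrix (Fin n) (Fin n) ℝ) :=
    { toFun := fun Ω i j => Ω.1 i - Ω.1 j
      map_add' := fun a b => by
        ext i j : 2
        simp only [Submodule.coe_add, Pi.add_apply]
        abel
      map_smul' := fun c a => by
        ext i j : 2
        simp [smul_sub] }
  let T : skewTuples k n →ₗ[ℝ] (Fin k → Fin k → Matrix (Fin n) (Fin n) ℝ) :=
    { toFun := fun Ω i j => if G.Adj i j then proj (y i j) * (Ω.1 i - Ω.1 j) else 0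
      map_add' := fun a b => by
        ext i j : 2
        simp only [Submodule.coe_add, Pi.add_apply]
        split_ifs
        · rw [← Matrix.mul_add]
          congr 1
          abel
        · simp
      map_smul' := fun c a => by
        ext i j : 2
        simp only [Submodule.coe_smul, Pi.smul_apply, RingHom.id_apply]
        split_ifs
        · rw [← smul_sub, Matrix.mul_smul]
        · simp }
  obtain ⟨C, hC, hle⟩ := exists_norm_le_mul_norm_of_ker_le T S (fun Ω hΩ => by
    have h1 := h Ω.1 Ω.2 fun i j hij => by
      have := congrFun (congrFun (LinearMap.mem_ker.1 hΩ) i) j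
      simpa [T, hij] using this
    refine LinearMap.mem_ker.2 ?_
    ext i j : 2
    exact sub_eq_zero.2 (h1 i j))
  refine ⟨k * (k * C ^ 2), by positivity, fun Ω hΩ => ?_⟩
  set W := ∑ i, ∑ j ∈ G.neighborFinset i, ‖proj (y i j) * (Ω i - Ω j)‖ ^ 2 with hW
  have hW0 : 0 ≤ W := Finset.sum_nonneg fun _ _ => Finset.sum_nonneg fun _ _ => sq_nonneg _
  have hT : ‖T ⟨Ω, hΩ⟩‖ ≤ √W := by
    refine (pi_norm_le_iff_of_nonneg (Real.sqrt_nonneg _)).2 fun i =>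
      (pi_norm_le_iff_of_nonneg (Real.sqrt_nonneg _)).2 fun j => ?_
    change ‖if G.Adj i j then proj (y i j) * (Ω i - Ω j) else 0‖ ≤ √W
    split_ifs with hij
    · refine Real.le_sqrt_of_sq_le ?_
      exact (Finset.single_le_sum (f := fun j => ‖proj (y i j) * (Ω i - Ω j)‖ ^ 2)
        (fun _ _ => sq_nonneg _) (show j ∈ G.neighborFinset i by simpa using hij)).trans
        (Finset.single_le_sum
          (f := fun i => ∑ j ∈ G.neighborFinset i, ‖proj (y i j) * (Ω i - Ω j)‖ ^ 2)
          (fun _ _ => Finset.sum_nonneg fun _ _ => sq_nonneg _) (Finset.mem_univ i))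
    · rw [norm_zero]
      exact Real.sqrt_nonneg _
  have hterm : ∀ i j, ‖Ω i - Ω j‖ ^ 2 ≤ C ^ 2 * W := fun i j => by
    have h1 : ‖Ω i - Ω j‖ ≤ C * √W :=
      ((norm_le_pi_norm (S ⟨Ω, hΩ⟩ i) j).trans (norm_le_pi_norm (S ⟨Ω, hΩ⟩) i)).trans
        ((hle _).trans (mul_le_mul_of_nonneg_left hT hC))
    calc ‖Ω i - Ω j‖ ^ 2 ≤ (C * √W) ^ 2 := pow_le_pow_left₀ (norm_nonneg _) h1 2
      _ = C ^ 2 * W := by rw [mul_pow, Real.sq_sqrt hW0]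
  refine (Finset.sum_le_sum fun i _ => Finset.sum_le_sum fun j _ => hterm i j).trans
    (le_of_eq ?_)
  simp
  ring

/-- The symmetric part of `P Rᵀ - 1` is exactly `-(P - R)(P - R)ᵀ / 2`, so a relative rotation is
`1` plus a skew matrix up to second order. -/
theorem norm_relative_sub_sk_le (P R : SO n) :
    ‖(P.1 * R.1ᵀ - 1) - sk (P.1 * R.1ᵀ)‖ ≤ ‖P.1 - R.1‖ ^ 2 / 2 := by
  have h : (P.1 * R.1ᵀ - 1) - sk (P.1 * R.1ᵀ) =
      -((1 / 2 : ℝ) • ((P.1 - R.1) * (P.1 - R.1)ᵀ)) := by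
    simp only [sk, Matrix.transpose_sub, Matrix.transpose_mul, Matrix.transpose_transpose,
      Matrix.sub_mul, Matrix.mul_sub, SO.mul_transpose_self]
    module
  rw [h, norm_neg, norm_smul]
  have := Matrix.frobenius_norm_mul (P.1 - R.1) (P.1 - R.1)ᵀ
  rw [Matrix.frobenius_norm_transpose] at this
  rw [Real.norm_of_nonneg (by norm_num)]
  linarith

theorem sq_le_of_le_add {a b c : ℝ} (ha : 0 ≤ a) (h : a ≤ b + c) :
    a ^ 2 ≤ 2 * b ^ 2 + 2 * c ^ 2 := by
  nlinarith [sq_nonneg (b - c)]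

/-- The skew parts of the rotations relative to agent `i₀` form a skew tuple, to which the linear
coercivity applies. Passing to it and back costs `O(V²)`, which is absorbed when `V` is small. -/
theorem InfRigid.exists_spread_le {G : SimpleGraph (Fin k)} [DecidableRel G.Adj]
    {y : Fin k → Fin k → EuclideanSpace ℝ (Fin n)} (hk : 1 ≤ k) (hy : IsReference G y)
    (h : InfRigid G y) :
    ∃ C, 0 < C ∧ ∃ v, 0 < v ∧ ∀ Q : State k n, spread Q ≤ v →
      spread Q ≤ C * edgeEnergy G y Q := by
  obtain ⟨C, hC, hco⟩ := h.exists_coercive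
  let i₀ : Fin k := ⟨0, hk⟩
  set K : ℝ := 4 * C * k ^ 2 + 2 * k ^ 2 with hK
  have hkpos : (0 : ℝ) < k := by exact_mod_cast hk
  have hK0 : 0 < K := by positivity
  -- The estimate obtained is `V ≤ 4 C W + K V²`, and `K V ≤ 1/2` turns it into `V ≤ 8 C W`. The
  -- added `1` keeps the constant positive when `C = 0`.
  refine ⟨8 * C + 1, by positivity, 1 / (2 * K), by positivity, fun Q hQ => ?_⟩
  set V := spread Q with hV
  have hV0 : 0 ≤ V := spread_nonneg Q
  set A : Fin k → Matrix (Fin n) (Fin n) ℝ := fun i => sk ((Q i).1 * (Q i₀).1ᵀ) with hA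
  have hdiff : ∀ i j, ‖((Q i).1 - (Q j).1) * (Q i₀).1ᵀ - (A i - A j)‖ ≤ V := fun i j => by
    have h1 := norm_relative_sub_sk_le (Q i) (Q i₀)
    have h2 := norm_relative_sub_sk_le (Q j) (Q i₀)
    have h3 := norm_sub_sq_le_spread Q i i₀
    have h4 := norm_sub_sq_le_spread Q j i₀
    have h5 : ((Q i).1 - (Q j).1) * (Q i₀).1ᵀ - (A i - A j) =
        (((Q i).1 * (Q i₀).1ᵀ - 1) - A i) - (((Q j).1 * (Q i₀).1ᵀ - 1) - A j) := by
      rw [Matrix.sub_mul]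
      abel
    rw [h5]
    refine (norm_sub_le _ _).trans ?_
    linarith
  have hupper : ∀ i j, ‖(Q i).1 - (Q j).1‖ ^ 2 ≤ 2 * ‖A i - A j‖ ^ 2 + 2 * V ^ 2 := fun i j => by
    refine sq_le_of_le_add (norm_nonneg _) ?_
    rw [← SO.norm_mul_transpose (Q i₀)]
    have := norm_add_le (A i - A j) (((Q i).1 - (Q j).1) * (Q i₀).1ᵀ - (A i - A j))
    rw [add_sub_cancel] at this
    exact this.trans (add_le_add_right (hdiff i j) _)
  have hlower : ∀ i, ∀ j ∈ G.neighborFinset i, ‖proj (y i j) * (A i - A j)‖ ^ 2 ≤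
      2 * ‖proj (y i j) * ((Q i).1 - (Q j).1)‖ ^ 2 + 2 * V ^ 2 := fun i j hj => by
    refine sq_le_of_le_add (norm_nonneg _) ?_
    have h1 : proj (y i j) * (A i - A j) = proj (y i j) * ((Q i).1 - (Q j).1) * (Q i₀).1ᵀ -
        proj (y i j) * (((Q i).1 - (Q j).1) * (Q i₀).1ᵀ - (A i - A j)) := by
      rw [Matrix.mul_sub _ _ (A i - A j), Matrix.mul_assoc]
      abel
    rw [h1]
    refine (norm_sub_le _ _).trans ?_
    rw [SO.norm_mul_transpose]
    refine add_le_add_right ((Matrix.frobenius_norm_mul _ _).trans ?_) _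
    rw [norm_proj, hy.unit i j (by simpa using hj), one_pow, one_mul]
    exact hdiff i j
  have h1 : V ≤ 2 * (∑ i, ∑ j, ‖A i - A j‖ ^ 2) + 2 * k ^ 2 * V ^ 2 := by
    refine (Finset.sum_le_sum fun i _ => Finset.sum_le_sum fun j _ => hupper i j).trans
      (le_of_eq ?_)
    simp only [Finset.sum_add_distrib, ← Finset.mul_sum]
    simp
    ring
  have h2 : ∑ i, ∑ j ∈ G.neighborFinset i, ‖proj (y i j) * (A i - A j)‖ ^ 2 ≤
      2 * edgeEnergy G y Q + 2 * k ^ 2 * V ^ 2 := by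
    refine (Finset.sum_le_sum fun i _ => Finset.sum_le_sum fun j hj => hlower i j hj).trans ?_
    rw [edgeEnergy]
    simp only [Finset.sum_add_distrib, Finset.mul_sum]
    refine add_le_add_right ?_ _
    have h3 : ∀ i, ∑ _j ∈ G.neighborFinset i, 2 * V ^ 2 ≤ k * (2 * V ^ 2) := fun i => by
      rw [Finset.sum_const, nsmul_eq_mul]
      refine mul_le_mul_of_nonneg_right ?_ (by positivity)
      exact_mod_cast (Finset.card_le_univ _).trans (by simp)
    refine (Finset.sum_le_sum fun i _ => h3 i).trans (le_of_eq ?_)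
    simp
    ring
  have h3 := hco A fun i => transpose_sk _
  have h4 : V ≤ 4 * C * edgeEnergy G y Q + K * V ^ 2 := by
    have h5 := mul_le_mul_of_nonneg_left h2 hC
    calc V ≤ 2 * (C * (2 * edgeEnergy G y Q + 2 * k ^ 2 * V ^ 2)) + 2 * k ^ 2 * V ^ 2 := by
          linarith
      _ = _ := by
          rw [hK]
          ring
  have h5 : K * V ≤ 1 / 2 := by
    calc K * V ≤ K * (1 / (2 * K)) := mul_le_mul_of_nonneg_left hQ hK0.le
      _ = 1 / 2 := by field_simp
  have h6 := mul_le_mul_of_nonneg_right h5 hV0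
  have h7 := edgeEnergy_nonneg (G := G) (y := y) Q
  nlinarith

theorem InfRigid.exists_spreadRate_le {G : SimpleGraph (Fin k)} [DecidableRel G.Adj]
    {y : Fin k → Fin k → EuclideanSpace ℝ (Fin n)} (hk : 1 ≤ k) (hy : IsReference G y)
    (h : InfRigid G y) :
    ∃ c, 0 < c ∧ ∃ v, 0 < v ∧ ∀ Q : State k n, spread Q ≤ v →
      spreadRate G y Q ≤ -c * spread Q := by
  obtain ⟨C, hC, v, hv, hle⟩ := h.exists_spread_le hk hy
  have hkpos : (0 : ℝ) < k := by exact_mod_cast hk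
  -- With this bound on `√V` the cubic error is at most `k V / C`, half of the decay term `2 k V /
  -- C`.
  set w : ℝ := 1 / (3 * C * k ^ 2) with hw
  have hw0 : 0 < w := by positivity
  refine ⟨k / C, by positivity, min v (w ^ 2), by positivity, fun Q hQ => ?_⟩
  have hV0 := spread_nonneg Q
  have h1 := spreadRate_le hy Q
  have h2 := hle Q (hQ.trans (min_le_left _ _))
  have hs : √(spread Q) ≤ w := Real.sqrt_le_iff.2 ⟨hw0.le, hQ.trans (min_le_right _ _)⟩
  have h3 : √(spread Q) ^ 3 ≤ w * spread Q := by
    calc √(spread Q) ^ 3 = √(spread Q) * √(spread Q) ^ 2 := by ring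
      _ = √(spread Q) * spread Q := by rw [Real.sq_sqrt hV0]
      _ ≤ _ := mul_le_mul_of_nonneg_right hs hV0
  have h4 : spread Q / C ≤ edgeEnergy G y Q := by
    rw [div_le_iff₀ hC]
    linarith
  calc spreadRate G y Q ≤ -2 * k * edgeEnergy G y Q + 3 * k ^ 3 * (√(spread Q)) ^ 3 := h1
    _ ≤ -2 * k * (spread Q / C) + 3 * k ^ 3 * (w * spread Q) := by
        have h5 := mul_le_mul_of_nonneg_left h4 (by positivity : (0 : ℝ) ≤ 2 * k)
        have h6 := mul_le_mul_of_nonneg_left h3 (by positivity : (0 : ℝ) ≤ 3 * k ^ 3)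
        linarith
    _ = -(k / C) * spread Q := by
        rw [hw]
        field_simp
        ring

end Rigidity

/-! ### Exponential decay from rigidity -/

section Decay

/-- A barrier argument, since the differential inequality is available only where `φ ≤ v`. The
barrier decays at half the rate and starts at `φ 0 + η > 0`, so the comparison at a contact point is
strict; it stays below `v`, so contact occurs only where the inequality holds. -/
theorem le_exp_mul_of_deriv_le {φ φ' : ℝ → ℝ} {c v : ℝ} (hc : 0 < c)
    (hφ : ∀ t, 0 ≤ t → HasDerivWithinAt φ (φ' t) (Set.Ici 0) t)
    (h0 : 0 ≤ φ 0) (hv : φ 0 < v) (hle : ∀ t, 0 ≤ t → φ t ≤ v → φ' t ≤ -c * φ t) {t : ℝ}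
    (ht : 0 ≤ t) : φ t ≤ Real.exp (-(c / 2) * t) * φ 0 := by
  have key : ∀ η, 0 < η → φ 0 + η ≤ v → φ t ≤ Real.exp (-(c / 2) * t) * (φ 0 + η) := by
    intro η hη hηv
    have hB : ∀ x, HasDerivAt (fun x => Real.exp (-(c / 2) * x) * (φ 0 + η))
        (-(c / 2) * (Real.exp (-(c / 2) * x) * (φ 0 + η))) x := fun x => by
      have h1 := ((hasDerivAt_id x).const_mul (-(c / 2))).exp.mul_const (φ 0 + η)
      refine h1.congr_deriv ?_
      simp
      ring
    refine image_le_of_deriv_right_lt_deriv_boundary (a := 0) (b := t)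
      (fun x hx => (hφ x hx.1).continuousWithinAt.mono Set.Icc_subset_Ici_self)
      (fun x hx => (hφ x hx.1).mono (Set.Ici_subset_Ici.2 hx.1)) (by simp [hη.le])
      hB (fun x hx hxe => ?_) ⟨ht, le_rfl⟩
    have hpos : 0 < Real.exp (-(c / 2) * x) * (φ 0 + η) := by positivity
    have hxv : φ x ≤ v := by
      rw [hxe]
      refine le_trans (mul_le_of_le_one_left (by positivity) ?_) hηv
      rw [Real.exp_le_one_iff]
      have := mul_nonneg (half_pos hc).le hx.1
      linarith
    have h2 := hle x hx.1 hxv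
    rw [hxe] at h2
    have := mul_pos (half_pos hc) hpos
    linarith
  refine le_of_forall_pos_le_add fun ε hε => ?_
  have h1 := key (min ε (v - φ 0)) (lt_min hε (by linarith))
    (by linarith [min_le_right ε (v - φ 0)])
  have h2 : Real.exp (-(c / 2) * t) ≤ 1 := by
    rw [Real.exp_le_one_iff]
    have := mul_nonneg (half_pos hc).le ht
    linarith
  have h3 : Real.exp (-(c / 2) * t) * min ε (v - φ 0) ≤ ε :=
    (mul_le_of_le_one_left (le_min hε.le (by linarith)) h2).trans (min_le_left _ _)
  linarith

variable {k n : ℕ} {G : SimpleGraph (Fin k)} [DecidableRel G.Adj]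
  {y : Fin k → Fin k → EuclideanSpace ℝ (Fin n)}

theorem InfRigid.locallyExponentiallyStable (hk : 1 ≤ k) (hy : IsReference G y)
    (h : InfRigid G y) : LocallyExponentiallyStable G y (stateSync k n) := by
  obtain ⟨c, hc, v, hv, hle⟩ := h.exists_spreadRate_le hk hy
  have hkpos : (0 : ℝ) < k := by exact_mod_cast hk
  -- The constants come from `d ≤ √V ≤ 2 k d`. The barrier loses one factor `2` in the rate and the
  -- square root another, whence `c / 4`.
  refine ⟨√v / (2 * k), by positivity, 2 * k, by positivity, c / 4, by positivity,
    fun Q hQ hQ0 t ht => ?_⟩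
  have h0 : spread (Q 0) < v := by
    have h1 := sqrt_spread_le_distTo (Q 0)
    rw [lt_div_iff₀ (by positivity)] at hQ0
    refine (Real.sqrt_lt_sqrt_iff (spread_nonneg _)).1 (h1.trans_lt ?_)
    linarith
  have h1 := le_exp_mul_of_deriv_le (φ := fun t => spread (Q t)) hc
    (fun t ht => hQ.hasDerivWithinAt_spread ht) (spread_nonneg _) h0
    (fun t _ hV => hle (Q t) hV) ht
  have h2 : Real.exp (-(c / 2) * t) = Real.exp (-(c / 4) * t) ^ 2 := by
    rw [← Real.exp_nat_mul]
    congr 1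
    push_cast
    ring
  calc distTo (stateSync k n) (Q t) ≤ √(spread (Q t)) := distTo_stateSync_le hk _
    _ ≤ √(Real.exp (-(c / 4) * t) ^ 2 * spread (Q 0)) := by
        rw [← h2]
        exact Real.sqrt_le_sqrt h1
    _ = Real.exp (-(c / 4) * t) * √(spread (Q 0)) := by
        rw [Real.sqrt_mul (by positivity), Real.sqrt_sq (Real.exp_pos _).le]
    _ ≤ Real.exp (-(c / 4) * t) * (2 * k * distTo (stateSync k n) (Q 0)) :=
        mul_le_mul_of_nonneg_left (sqrt_spread_le_distTo _) (Real.exp_pos _).le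
    _ = _ := by ring

end Decay

end PartialSync
end

noncomputable section
namespace PartialSync

attribute [local instance] Matrix.frobeniusNormedAddCommGroup Matrix.frobeniusNormedSpace

/-! ### The quadratic form of the generalized Laplacian and part (a) -/

section Laplacian

variable {k n : ℕ}

/-- The `kn × n` matrix with blocks `X_1, …, X_k` placed below one another. -/
def stack (X : Fin k → Matrix (Fin n) (Fin n) ℝ) : Matrix (Fin k × Fin n) (Fin n) ℝ :=
  Matrix.of fun p c => X p.1 p.2 c

theorem vecStack_eq (X : Fin k → Matrix (Fin n) (Fin n) ℝ) :
    (vecStack X).ofLp = Matrix.vec (stack X) := rfl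

variable {G : SimpleGraph (Fin k)} [DecidableRel G.Adj]
  {y : Fin k → Fin k → EuclideanSpace ℝ (Fin n)}

theorem genLaplacian_mulVec (x : Fin k × Fin n → ℝ) (i : Fin k) (r : Fin n) :
    (genLaplacian G y *ᵥ x) (i, r) = ∑ j ∈ G.neighborFinset i,
      (proj (y i j) *ᵥ fun s => x (i, s) - x (j, s)) r := by
  have hL : ∀ q : Fin k × Fin n, genLaplacian G y (i, r) q =
      (if i = q.1 then ∑ j ∈ G.neighborFinset i, proj (y i j) r q.2 else 0) -
        (if q.1 ∈ G.neighborFinset i then proj (y i q.1) r q.2 else 0) := by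
    intro q
    simp only [genLaplacian, Matrix.of_apply, SimpleGraph.adjMatrix_apply,
      SimpleGraph.mem_neighborFinset]
    split_ifs with h1 h2 h2
    -- A diagonal block receives no adjacency contribution because the graph has no loops.
    · exact absurd (h1 ▸ h2) (G.loopless.irrefl _)
    · rw [sub_zero, SimpleGraph.neighborFinset_eq_filter, Finset.sum_filter]
      refine Finset.sum_congr rfl fun j _ => ?_
      split_ifs <;> simp
    · simp
    · simp
  simp only [Matrix.mulVec, dotProduct, hL, Fintype.sum_prod_type, sub_mul, ite_mul, zero_mul,
    Finset.sum_sub_distrib, mul_sub]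
  congr 1
  · rw [Finset.sum_eq_single i (fun j _ hj => by simp [hj.symm]) (by simp)]
    simp only [if_true, Finset.sum_mul]
    exact Finset.sum_comm
  · rw [← Finset.sum_filter_add_sum_filter_not Finset.univ (fun j => j ∈ G.neighborFinset i)]
    rw [Finset.sum_eq_zero (s := Finset.filter (fun j => j ∉ G.neighborFinset i) Finset.univ)
      (fun j hj => by simp [(Finset.mem_filter.1 hj).2]), add_zero]
    refine Finset.sum_congr (Finset.filter_univ_mem _) fun j hj => ?_
    simp only [if_pos hj]

theorem genLaplacian_mul_stack (X : Fin k → Matrix (Fin n) (Fin n) ℝ) :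
    genLaplacian G y * stack X =
      stack fun i => ∑ j ∈ G.neighborFinset i, proj (y i j) * (X i - X j) := by
  ext ⟨i, r⟩ c
  have := genLaplacian_mulVec (G := G) (y := y) (fun p => X p.1 p.2 c) i r
  simp only [stack, Matrix.of_apply, Matrix.sum_apply]
  exact this

/-- Summation by parts over oriented edges: each `‖M (X_i - X_j)‖²` splits into one term at either
endpoint, and both sums agree after swapping the endpoints. Hence the `1 / 2`. -/
theorem trace_stack_genLaplacian (hy : IsReference G y) (X : Fin k → Matrix (Fin n) (Fin n) ℝ) :
    ((stack X)ᵀ * (genLaplacian G y * stack X)).trace =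
      1 / 2 * ∑ i, ∑ j ∈ G.neighborFinset i, ‖proj (y i j) * (X i - X j)‖ ^ 2 := by
  have h1 : ∀ Y : Fin k → Matrix (Fin n) (Fin n) ℝ,
      ((stack X)ᵀ * stack Y).trace = ∑ i, frobInner (X i) (Y i) := fun Y => by
    simp only [frobInner_eq_sum, Matrix.trace, Matrix.diag_apply, Matrix.mul_apply,
      Matrix.transpose_apply, Fintype.sum_prod_type, stack, Matrix.of_apply]
    rw [Finset.sum_comm]
    exact Finset.sum_congr rfl fun i _ => Finset.sum_comm
  have h2 : ∀ i, ∀ j ∈ G.neighborFinset i, ‖proj (y i j) * (X i - X j)‖ ^ 2 =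
      frobInner (X i) (proj (y i j) * (X i - X j)) +
        frobInner (X j) (proj (y j i) * (X j - X i)) := fun i j hj => by
    have hadj : G.Adj i j := by simpa using hj
    rw [← frobInner_self, frobInner_mul_right, transpose_proj, ← Matrix.mul_assoc,
      proj_mul_self (hy.unit i j hadj), ← hy.symm i j hadj, frobInner_sub_right,
      ← neg_sub (X i) (X j), Matrix.mul_neg, frobInner_neg_right,
      frobInner_comm _ (X i), frobInner_comm _ (X j), ← sub_eq_add_neg]
  rw [genLaplacian_mul_stack, h1,
    Finset.sum_congr rfl fun i _ => Finset.sum_congr rfl fun j hj => h2 i j hj]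
  simp only [Finset.sum_add_distrib, frobInner_sum_right]
  rw [← sum_neighbors_comm (fun i j => frobInner (X i) (proj (y i j) * (X i - X j)))]
  ring

theorem trace_genLaplacian_eq_zero_iff (hy : IsReference G y)
    (X : Fin k → Matrix (Fin n) (Fin n) ℝ) :
    ((stack X)ᵀ * (genLaplacian G y * stack X)).trace = 0 ↔
      ∀ i j, G.Adj i j → proj (y i j) * (X i - X j) = 0 := by
  rw [trace_stack_genLaplacian hy, mul_eq_zero, or_iff_right (by norm_num),
    Finset.sum_eq_zero_iff_of_nonneg fun _ _ => Finset.sum_nonneg fun _ _ => sq_nonneg _]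
  simp only [Finset.mem_univ, true_imp_iff]
  refine forall_congr' fun i => ?_
  rw [Finset.sum_eq_zero_iff_of_nonneg fun _ _ => sq_nonneg _]
  simp

theorem genLaplacian_mul_stack_eq_zero {X : Fin k → Matrix (Fin n) (Fin n) ℝ}
    (h : ∀ i j, G.Adj i j → proj (y i j) * (X i - X j) = 0) :
    genLaplacian G y * stack X = 0 := by
  rw [genLaplacian_mul_stack]
  have : (fun i => ∑ j ∈ G.neighborFinset i, proj (y i j) * (X i - X j)) = 0 :=
    funext fun i => Finset.sum_eq_zero fun j hj => h i j (by simpa using hj)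
  rw [this]
  rfl

/-- The vectors with equal blocks always form an `n`-dimensional subspace of the kernel, and the
rank hypothesis leaves room for nothing else. The argument then applies to each column of the
stacked matrix. -/
theorem eq_of_rank_genLaplacian (hk : 1 ≤ k)
    (hr : (genLaplacian G y).rank = n * (k - 1)) {X : Fin k → Matrix (Fin n) (Fin n) ℝ}
    (h : ∀ i j, G.Adj i j → proj (y i j) * (X i - X j) = 0) (i j : Fin k) : X i = X j := by
  let D : (Fin n → ℝ) →ₗ[ℝ] (Fin k × Fin n → ℝ) := LinearMap.funLeft ℝ ℝ Prod.snd
  have hD : LinearMap.range D ≤ LinearMap.ker (genLaplacian G y).mulVecLin := by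
    rintro _ ⟨v, rfl⟩
    refine LinearMap.mem_ker.2 (funext fun p => ?_)
    rw [Matrix.mulVecLin_apply, genLaplacian_mulVec]
    simp [D, LinearMap.funLeft, Matrix.mulVec, dotProduct]
  have hDr : Module.finrank ℝ (LinearMap.range D) = n := by
    rw [LinearMap.finrank_range_of_inj]
    · simp
    · exact LinearMap.funLeft_injective_of_surjective ℝ ℝ _
        fun r => ⟨(⟨0, hk⟩, r), rfl⟩
  have hker : Module.finrank ℝ (LinearMap.ker (genLaplacian G y).mulVecLin) = n := by
    have h1 := LinearMap.finrank_range_add_finrank_ker (genLaplacian G y).mulVecLin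
    rw [← Matrix.rank, hr] at h1
    simp only [Module.finrank_fintype_fun_eq_card, Fintype.card_prod, Fintype.card_fin] at h1
    obtain ⟨m, rfl⟩ : ∃ m, k = m + 1 := ⟨k - 1, by omega⟩
    rw [Nat.add_sub_cancel] at h1
    nlinarith
  have heq := Submodule.eq_of_le_of_finrank_eq hD (hDr.trans hker.symm)
  have h0 := genLaplacian_mul_stack_eq_zero h
  ext r c
  have hc : (fun p => stack X p c) ∈ LinearMap.ker (genLaplacian G y).mulVecLin :=
    LinearMap.mem_ker.2 (funext fun p => congrFun (congrFun h0 p) c)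
  rw [← heq] at hc
  obtain ⟨v, hv⟩ := hc
  exact (congrFun hv (i, r)).symm.trans (congrFun hv (j, r))

theorem infRigid_of_rank_genLaplacian (hk : 1 ≤ k)
    (hr : (genLaplacian G y).rank = n * (k - 1)) : InfRigid G y :=
  fun _ _ h => eq_of_rank_genLaplacian hk hr h

theorem mem_outputSync_iff {G : SimpleGraph (Fin k)} (hy : IsReference G y) (Q : State k n) :
    Q ∈ outputSync G y ↔ ∀ i j, G.Adj i j → proj (y i j) * ((Q i).1 - (Q j).1) = 0 := by
  refine forall_congr' fun i => forall_congr' fun j => forall_congr' fun h => ?_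
  rw [proj_mul_eq_zero_iff (hy.unit i j h), Matrix.transpose_sub, Matrix.sub_mulVec, sub_eq_zero]

theorem outputSync_eq_of_rank_genLaplacian (hk : 1 ≤ k) (hy : IsReference G y)
    (hr : (genLaplacian G y).rank = n * (k - 1)) : outputSync G y = stateSync k n := by
  ext Q
  rw [mem_outputSync_iff hy]
  constructor
  · intro h i j
    exact Subtype.ext (eq_of_rank_genLaplacian (X := fun i => (Q i).1) hk hr h i j)
  · intro h i j _
    rw [h i j, sub_self, Matrix.mul_zero]

end Laplacian

/-! ### The rank condition in (b) as infinitesimal rigidity -/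

section SkewRank

variable {k n : ℕ}

/-- The skew-symmetric matrices. -/
def skewMatrices (n : ℕ) : Submodule ℝ (Matrix (Fin n) (Fin n) ℝ) where
  carrier := {Ω | Ωᵀ = -Ω}
  add_mem' {a b} ha hb := by
    change (a + b)ᵀ = -(a + b)
    rw [Matrix.transpose_add, ha, hb]
    abel
  zero_mem' := by simp
  smul_mem' c a ha := by
    change (c • a)ᵀ = -(c • a)
    rw [Matrix.transpose_smul, ha, smul_neg]

theorem finrank_skewTuples : Module.finrank ℝ (skewTuples k n) =
    k * Module.finrank ℝ (skewMatrices n) := by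
  let e : skewTuples k n ≃ₗ[ℝ] (Fin k → skewMatrices n) :=
    { toFun := fun Ω i => ⟨Ω.1 i, Ω.2 i⟩
      invFun := fun Ω => ⟨fun i => (Ω i).1, fun i => (Ω i).2⟩
      map_add' := fun _ _ => rfl
      map_smul' := fun _ _ => rfl
      left_inv := fun _ => rfl
      right_inv := fun _ => rfl }
  rw [e.finrank_eq, Module.finrank_pi_fintype]
  simp

/-- The isometric embedding of the skew-symmetric tuples given by `vecStack`. -/
def vecSkew (k n : ℕ) : skewTuples k n →ₗ[ℝ] VecSpace k n where
  toFun Ω := vecStack Ω.1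
  map_add' _ _ := rfl
  map_smul' _ _ := rfl

theorem vecSkew_injective : Function.Injective (vecSkew k n) := fun A B h => by
  refine Subtype.ext (funext fun i => Matrix.ext fun a b => ?_)
  exact congrFun (congrArg WithLp.ofLp h) (b, (i, a))

theorem range_vecSkew : (LinearMap.range (vecSkew k n) : Set (VecSpace k n)) =
    vecStack '' {Ω | ∀ i, Ω i ∈ LieAlgebra.Orthogonal.so (Fin n) ℝ} := by
  ext x
  simp only [LieAlgebra.Orthogonal.mem_so]
  constructor
  · rintro ⟨Ω, rfl⟩
    exact ⟨Ω.1, Ω.2, rfl⟩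
  · rintro ⟨Ω, hΩ, rfl⟩
    exact ⟨⟨Ω, hΩ⟩, rfl⟩

variable {V : Matrix (Fin n × (Fin k × Fin n)) (Fin (k * (n * (n - 1) / 2))) ℝ}

theorem IsSkewBasis.span_eq (hV : IsSkewBasis V) :
    Submodule.span ℝ (Set.range fun c => (WithLp.toLp 2 (V.col c) : VecSpace k n)) =
      LinearMap.range (vecSkew k n) :=
  SetLike.coe_injective (hV.2.trans range_vecSkew.symm)

theorem toLp_mulVec {ι : Type*} [Fintype ι] (U : Matrix (Fin n × (Fin k × Fin n)) ι ℝ)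
    (v : ι → ℝ) :
    (WithLp.toLp 2 (U *ᵥ v) : VecSpace k n) = ∑ c, v c • WithLp.toLp 2 (U.col c) := by
  ext p
  simp [Matrix.mulVec, dotProduct, Matrix.col, mul_comm]

/-- The coordinates on the skew-symmetric tuples given by a skew basis. -/
theorem IsSkewBasis.exists_equiv (hV : IsSkewBasis V) :
    ∃ e : (Fin (k * (n * (n - 1) / 2)) → ℝ) ≃ₗ[ℝ] skewTuples k n,
      ∀ v, V *ᵥ v = Matrix.vec (stack (e v).1) := by
  have hli := hV.1.linearIndependent
  let e₁ := (Module.Basis.span hli).equivFun.symm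
  let e₂ := (LinearEquiv.ofInjective (vecSkew k n) vecSkew_injective).symm
  let e₃ := LinearEquiv.ofEq _ _ hV.span_eq
  refine ⟨e₁ ≪≫ₗ e₃ ≪≫ₗ e₂, fun v => ?_⟩
  rw [← vecStack_eq]
  have h1 : vecStack ((e₁ ≪≫ₗ e₃ ≪≫ₗ e₂) v).1 = (e₃ (e₁ v) : VecSpace k n) := by
    have := (LinearEquiv.ofInjective (vecSkew k n) vecSkew_injective).apply_symm_apply
      (e₃ (e₁ v))
    exact congrArg Subtype.val this
  have h2 : (e₃ (e₁ v) : VecSpace k n) = WithLp.toLp 2 (V *ᵥ v) := by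
    rw [toLp_mulVec]
    change ((e₁ v : _) : VecSpace k n) = _
    simp only [e₁, Module.Basis.equivFun_symm_apply, Submodule.coe_sum, Submodule.coe_smul,
      Module.Basis.span_apply]
  rw [h1, h2]

/-- The dimension of `so(n)` is read off from the number of columns of the given basis, so no direct
count is needed for general `n`. -/
theorem IsSkewBasis.finrank_skewMatrices (hk : 1 ≤ k) (hV : IsSkewBasis V) :
    Module.finrank ℝ (skewMatrices n) = n * (n - 1) / 2 := by
  obtain ⟨e, -⟩ := hV.exists_equiv
  have h := e.finrank_eq
  rw [finrank_skewTuples, Module.finrank_fintype_fun_eq_card, Fintype.card_fin] at h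
  exact (Nat.eq_of_mul_eq_mul_left hk h).symm

variable {G : SimpleGraph (Fin k)} [DecidableRel G.Adj]
  {y : Fin k → Fin k → EuclideanSpace ℝ (Fin n)}

/-- The skew-symmetric tuples preserving the output synchronization to first order. -/
def infMotions (G : SimpleGraph (Fin k)) (y : Fin k → Fin k → EuclideanSpace ℝ (Fin n)) :
    Submodule ℝ (skewTuples k n) where
  carrier := {Ω | ∀ i j, G.Adj i j → proj (y i j) * (Ω.1 i - Ω.1 j) = 0}
  add_mem' {a b} ha hb i j h := by
    have h1 := ha i j h
    have h2 := hb i j h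
    rw [Matrix.mul_sub, sub_eq_zero] at h1 h2 ⊢
    simp only [Submodule.coe_add, Pi.add_apply, Matrix.mul_add, h1, h2]
  zero_mem' i j _ := by simp
  smul_mem' c a ha i j h := by
    simp only [Submodule.coe_smul, Pi.smul_apply, ← smul_sub, Matrix.mul_smul, ha i j h, smul_zero]

/-- The constant embedding of the skew-symmetric matrices. -/
def constSkew (k n : ℕ) : skewMatrices n →ₗ[ℝ] skewTuples k n where
  toFun Ω := ⟨fun _ => Ω.1, fun _ => Ω.2⟩
  map_add' _ _ := rfl
  map_smul' _ _ := rfl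

theorem infRigid_iff_finrank {G : SimpleGraph (Fin k)} (hk : 1 ≤ k) :
    InfRigid G y ↔
      Module.finrank ℝ (infMotions G y) = Module.finrank ℝ (skewMatrices n) := by
  have hle : LinearMap.range (constSkew k n) ≤ infMotions G y := by
    rintro _ ⟨Ω, rfl⟩ i j _
    simp [constSkew]
  have hr : Module.finrank ℝ (LinearMap.range (constSkew k n)) =
      Module.finrank ℝ (skewMatrices n) :=
    LinearMap.finrank_range_of_inj fun A B h =>
      Subtype.ext (congrFun (congrArg Subtype.val h) ⟨0, hk⟩)
  constructor
  · intro h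
    have heq : infMotions G y = LinearMap.range (constSkew k n) :=
      le_antisymm (fun Ω hΩ => ⟨⟨Ω.1 ⟨0, hk⟩, Ω.2 _⟩,
        Subtype.ext (funext fun i => h Ω.1 Ω.2 hΩ _ _)⟩) hle
    rw [heq, hr]
  · intro h Ω hΩ hM i j
    have heq := Submodule.eq_of_le_of_finrank_eq hle (hr.trans h.symm)
    have hmem : (⟨Ω, hΩ⟩ : skewTuples k n) ∈ infMotions G y := hM
    rw [← heq] at hmem
    obtain ⟨A, hA⟩ := hmem
    have h1 := congrArg Subtype.val hA
    exact (congrFun h1 i).symm.trans (congrFun h1 j)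

/-- Compressing by `V` creates no new kernel, because the form is nonnegative: a kernel vector has
`tr(Xᵀ L^g X) = 0`, a sum of squares over the edges. -/
theorem IsSkewBasis.ker_eq (hy : IsReference G y)
    {e : (Fin (k * (n * (n - 1) / 2)) → ℝ) ≃ₗ[ℝ] skewTuples k n}
    (he : ∀ v, V *ᵥ v = Matrix.vec (stack (e v).1)) :
    LinearMap.ker (Vᵀ * ((1 : Matrix (Fin n) (Fin n) ℝ) ⊗ₖ genLaplacian G y) * V).mulVecLin =
      (infMotions G y).comap e.toLinearMap := by
  have hmul : ∀ v, (Vᵀ * ((1 : Matrix (Fin n) (Fin n) ℝ) ⊗ₖ genLaplacian G y) * V) *ᵥ v =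
      Vᵀ *ᵥ Matrix.vec (genLaplacian G y * stack (e v).1) := fun v => by
    rw [← Matrix.mulVec_mulVec, ← Matrix.mulVec_mulVec, he, Matrix.kronecker_mulVec_vec,
      Matrix.transpose_one, Matrix.mul_one]
  ext v
  rw [LinearMap.mem_ker, Matrix.mulVecLin_apply, hmul]
  constructor
  · intro h
    refine (trace_genLaplacian_eq_zero_iff hy (e v).1).1 ?_
    rw [← Matrix.vec_dotProduct_vec, ← he v, dotProduct_comm, Matrix.dotProduct_mulVec,
      ← Matrix.mulVec_transpose, h, zero_dotProduct]
  · intro h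
    rw [genLaplacian_mul_stack_eq_zero (X := (e v).1) h, Matrix.vec_zero, Matrix.mulVec_zero]

theorem IsSkewBasis.rank_eq_iff (hk : 1 ≤ k) (hy : IsReference G y) (hV : IsSkewBasis V) :
    (Vᵀ * ((1 : Matrix (Fin n) (Fin n) ℝ) ⊗ₖ genLaplacian G y) * V).rank =
      (k - 1) * (n * (n - 1) / 2) ↔ InfRigid G y := by
  obtain ⟨e, he⟩ := hV.exists_equiv
  rw [infRigid_iff_finrank hk, hV.finrank_skewMatrices hk]
  have h1 := LinearMap.finrank_range_add_finrank_ker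
    (Vᵀ * ((1 : Matrix (Fin n) (Fin n) ℝ) ⊗ₖ genLaplacian G y) * V).mulVecLin
  rw [← Matrix.rank, IsSkewBasis.ker_eq hy he, Module.finrank_fintype_fun_eq_card,
    Fintype.card_fin] at h1
  have h2 : Module.finrank ℝ ((infMotions G y).comap e.toLinearMap) =
      Module.finrank ℝ (infMotions G y) :=
    (e.ofSubmodule' (infMotions G y)).finrank_eq
  rw [h2] at h1
  have key : ∀ r z d k : ℕ, 1 ≤ k → r + z = k * d → (r = (k - 1) * d ↔ z = d) := by
    intro r z d k hk h
    obtain ⟨m, rfl⟩ : ∃ m, k = m + 1 := ⟨k - 1, by omega⟩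
    rw [Nat.succ_mul] at h
    rw [Nat.add_sub_cancel]
    omega
  exact key _ _ _ _ hk h1

theorem exists_isSkewBasis (h : Module.finrank ℝ (skewMatrices n) = n * (n - 1) / 2) :
    ∃ V : Matrix (Fin n × (Fin k × Fin n)) (Fin (k * (n * (n - 1) / 2))) ℝ, IsSkewBasis V := by
  have hfin : Module.finrank ℝ (LinearMap.range (vecSkew k n)) = k * (n * (n - 1) / 2) := by
    rw [LinearMap.finrank_range_of_inj vecSkew_injective, finrank_skewTuples, h]
  let b := (stdOrthonormalBasis ℝ (LinearMap.range (vecSkew k n))).reindex (finCongr hfin)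
  refine ⟨Matrix.of fun p c => (b c : VecSpace k n) p, ?_⟩
  have hcol : (fun c => (WithLp.toLp 2
      ((Matrix.of fun p c => (b c : VecSpace k n) p).col c) : VecSpace k n)) =
      fun c => (b c : VecSpace k n) := rfl
  refine ⟨?_, ?_⟩
  · rw [hcol]
    exact b.orthonormal.comp_linearIsometry (LinearMap.range (vecSkew k n)).subtypeₗᵢ
  · rw [hcol, ← range_vecSkew]
    have h1 : (Set.range fun c => (b c : VecSpace k n)) =
        (LinearMap.range (vecSkew k n)).subtype '' Set.range b := by
      rw [← Set.range_comp]
      rfl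
    rw [h1, Submodule.span_image]
    have h2 := b.toBasis.span_eq
    rw [b.coe_toBasis] at h2
    rw [h2, Submodule.map_top, Submodule.range_subtype]

end SkewRank

end PartialSync
end

noncomputable section
namespace PartialSync

/-! ### Global existence of solutions -/

section ODE

open Set NNReal

/-- Forward global existence for a bounded Lipschitz vector field. -/
theorem exists_forward_solution {E : Type*} [NormedAddCommGroup E] [NormedSpace ℝ E]
    [CompleteSpace E] {F : E → E} {K L : ℝ≥0} (hK : LipschitzWith K F) (hL : ∀ x, ‖F x‖ ≤ L)
    (x₀ : E) :
    ∃ γ : ℝ → E, γ 0 = x₀ ∧ ∀ t, 0 ≤ t → HasDerivWithinAt γ (F (γ t)) (Ici 0) t := by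
  have hex : ∀ N : ℕ, ∃ α : ℝ → E, α 0 = x₀ ∧
      ∀ t ∈ Icc (0 : ℝ) N, HasDerivWithinAt α (F (α t)) (Icc 0 N) t := fun N => by
    have h : IsPicardLindelof (fun _ => F) (tmin := 0) (tmax := N)
        -- Global bounds on the field allow the ball radius `L * N`, so one Picard–Lindelöf step
        -- covers all of `[0, N]`.
        ⟨0, ⟨le_rfl, Nat.cast_nonneg N⟩⟩ x₀ (L * N) 0 L K :=
      IsPicardLindelof.of_time_independent (fun x _ => hL x) hK.lipschitzOnWith (by simp)
    exact h.exists_eq_forall_mem_Icc_hasDerivWithinAt₀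
  choose α hα0 hα using hex
  have hmono : ∀ N M : ℕ, N ≤ M → EqOn (α N) (α M) (Icc 0 N) := fun N M hNM => by
    have hsub : Icc (0 : ℝ) N ⊆ Icc 0 M := Icc_subset_Icc_right (by exact_mod_cast hNM)
    have hderiv : ∀ P : ℕ, N ≤ P → ∀ t ∈ Ico (0 : ℝ) N,
        HasDerivWithinAt (α P) (F (α P t)) (Ici t) t := fun P hP t ht => by
      have htP : t < P := ht.2.trans_le (by exact_mod_cast hP)
      refine (hα P t ⟨ht.1, htP.le⟩).mono_of_mem_nhdsWithin ?_
      exact Filter.mem_of_superset (Icc_mem_nhdsGE htP) (Icc_subset_Icc_left ht.1)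
    exact ODE_solution_unique (v := fun _ => F) (fun _ => hK)
      (fun t ht => (hα N t ht).continuousWithinAt)
      (hderiv N le_rfl) (fun t ht => ((hα M t (hsub ht)).continuousWithinAt).mono hsub)
      (hderiv M hNM) ((hα0 N).trans (hα0 M).symm)
  have heq : ∀ (N M : ℕ) (t : ℝ), 0 ≤ t → t ≤ N → t ≤ M → α N t = α M t :=
    fun N M t h0 hN hM => by
      rcases le_total N M with h | h
      · exact hmono N M h ⟨h0, hN⟩
      · exact (hmono M N h ⟨h0, hM⟩).symm
  have hceil : ∀ t : ℝ, t ≤ ((⌈t⌉₊ + 1 : ℕ) : ℝ) := fun t => by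
    push_cast
    linarith [Nat.le_ceil t]
  -- The added `1` puts `t` strictly inside the interval of the chosen piece, so that piece
  -- describes the glued curve near `t`.
  refine ⟨fun t => α (⌈t⌉₊ + 1) t, hα0 _, fun t ht => ?_⟩
  have htN : t < ((⌈t⌉₊ + 1 : ℕ) : ℝ) := by
    push_cast
    linarith [Nat.le_ceil t]
  have h1 : HasDerivWithinAt (α (⌈t⌉₊ + 1)) (F (α (⌈t⌉₊ + 1) t)) (Ici 0) t := by
    refine (hα _ t ⟨ht, htN.le⟩).mono_of_mem_nhdsWithin ?_
    rw [← Ici_inter_Iic]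
    exact Filter.inter_mem self_mem_nhdsWithin (mem_nhdsWithin_of_mem_nhds (Iic_mem_nhds htN))
  refine h1.congr_of_eventuallyEq ?_ rfl
  filter_upwards [self_mem_nhdsWithin, mem_nhdsWithin_of_mem_nhds (Iic_mem_nhds htN)]
    with s hs0 hsN
  exact heq _ _ s hs0 (hceil s) hsN

/-- Every point has a forward trajectory of a smooth field multiplied by a cut-off function that
equals one on a large ball. -/
theorem exists_forward_solution_cutoff {E : Type*} [NormedAddCommGroup E] [NormedSpace ℝ E]
    [FiniteDimensional ℝ E] {F : E → E} (hF : ContDiff ℝ 1 F) (x₀ : E) :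
    ∃ χ : E → ℝ, (∀ x, ‖x‖ ≤ 1 → χ x = 1) ∧ ∃ γ : ℝ → E, γ 0 = x₀ ∧
      ∀ t, 0 ≤ t → HasDerivWithinAt γ (χ (γ t) • F (γ t)) (Ici 0) t := by
  let χ : ContDiffBump (0 : E) := ⟨1, 2, one_pos, one_lt_two⟩
  have hsmooth : ContDiff ℝ 1 fun x => χ x • F x := χ.contDiff.smul hF
  have hsupp : HasCompactSupport fun x => χ x • F x := χ.hasCompactSupport.smul_right
  obtain ⟨K, hK⟩ := hsmooth.lipschitzWith_of_hasCompactSupport hsupp (by norm_num)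
  obtain ⟨L, hL⟩ := hsmooth.continuous.bounded_above_of_compact_support hsupp
  have : CompleteSpace E := FiniteDimensional.complete ℝ E
  obtain ⟨γ, h0, hγ⟩ := exists_forward_solution hK (L := L.toNNReal)
    (fun x => (hL x).trans (Real.le_coe_toNNReal L)) x₀
  refine ⟨χ, fun x hx => ?_, γ, h0, hγ⟩
  exact χ.one_of_mem_closedBall (by simpa using hx)

end ODE

section Smoothness

variable {k n : ℕ}

/-- The right-hand side of the coupling law on arbitrary tuples of matrices. -/
def ambientVelocity (G : SimpleGraph (Fin k)) [DecidableRel G.Adj]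
    (y : Fin k → Fin k → EuclideanSpace ℝ (Fin n)) (X : Fin k → Fin n → Fin n → ℝ) (i : Fin k) :
    Matrix (Fin n) (Fin n) ℝ :=
  ∑ j ∈ G.neighborFinset i, sk ((Matrix.of (X i))ᵀ * proj (y i j) * Matrix.of (X j))

theorem contDiff_ambientField (G : SimpleGraph (Fin k)) [DecidableRel G.Adj]
    (y : Fin k → Fin k → EuclideanSpace ℝ (Fin n)) :
    ContDiff ℝ 1 fun (X : Fin k → Fin n → Fin n → ℝ) (i : Fin k) (a b : Fin n) =>
      (Matrix.of (X i) * ambientVelocity G y X i) a b := by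
  refine contDiff_pi.2 fun i => contDiff_pi.2 fun a => contDiff_pi.2 fun b => ?_
  simp only [ambientVelocity, sk, Matrix.mul_apply, Matrix.sum_apply, Matrix.smul_apply,
    Matrix.sub_apply, Matrix.transpose_apply, Matrix.of_apply]
  fun_prop

end Smoothness

section Existence

attribute [local instance] Matrix.frobeniusNormedAddCommGroup Matrix.frobeniusNormedSpace

variable {n : ℕ}

theorem hasDerivWithinAt_mul_entries {A B : ℝ → Matrix (Fin n) (Fin n) ℝ}
    {A' B' : Matrix (Fin n) (Fin n) ℝ} {s : Set ℝ} {t : ℝ}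
    (hA : ∀ a b, HasDerivWithinAt (fun u => A u a b) (A' a b) s t)
    (hB : ∀ a b, HasDerivWithinAt (fun u => B u a b) (B' a b) s t) (a b : Fin n) :
    HasDerivWithinAt (fun u => (A u * B u) a b) ((A' * B t + A t * B') a b) s t := by
  simp only [Matrix.mul_apply, Matrix.add_apply, ← Finset.sum_add_distrib]
  exact HasDerivWithinAt.fun_sum fun c _ => (hA a c).mul (hB c b)

/-- Both pairings reduce to a symmetric matrix (`Aᵀ A` or `A Aᵀ`) against a skew one. Applied to `A
= Xᵀ X - 1`, this keeps the orthogonality defect constant. -/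
theorem frobInner_commutator_eq_zero {Z : Matrix (Fin n) (Fin n) ℝ} (hZ : Zᵀ = -Z)
    (A : Matrix (Fin n) (Fin n) ℝ) : frobInner A (A * Z - Z * A) = 0 := by
  have h1 : sk (Aᵀ * A) = 0 :=
    sk_eq_zero_of_symm (by rw [Matrix.transpose_mul, Matrix.transpose_transpose])
  have h2 : sk (A * Aᵀ) = 0 :=
    sk_eq_zero_of_symm (by rw [Matrix.transpose_mul, Matrix.transpose_transpose])
  rw [frobInner_sub_right, frobInner_mul_right, frobInner_mul_right', frobInner_skew_right hZ _,
    frobInner_skew_right hZ (A * Aᵀ), h1, h2, sub_self]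

/-- Orthogonality is preserved by `X' = X Z` with `Z` skew-symmetric. -/
theorem transpose_mul_self_eq_one_of_deriv {X Z : ℝ → Matrix (Fin n) (Fin n) ℝ}
    (hZ : ∀ t, (Z t)ᵀ = -Z t)
    (hX : ∀ t, 0 ≤ t → ∀ a b,
      HasDerivWithinAt (fun s => X s a b) ((X t * Z t) a b) (Set.Ici 0) t)
    (h0 : (X 0)ᵀ * X 0 = 1) {t : ℝ} (ht : 0 ≤ t) : (X t)ᵀ * X t = 1 := by
  have hderiv : ∀ t, 0 ≤ t → HasDerivWithinAt (fun s => ‖(X s)ᵀ * X s - 1‖ ^ 2) 0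
      (Set.Ici 0) t := by
    intro t ht
    have h1 := hasDerivWithinAt_norm_sq (A := fun s => (X s)ᵀ * X s - 1) (s := Set.Ici 0) (t := t)
      (A' := (X t * Z t)ᵀ * X t + (X t)ᵀ * (X t * Z t)) fun a b =>
        (hasDerivWithinAt_mul_entries (fun a b => hX t ht b a) (hX t ht) a b).sub_const _
    refine h1.congr_deriv ?_
    have h2 : (X t * Z t)ᵀ * X t + (X t)ᵀ * (X t * Z t) =
        ((X t)ᵀ * X t - 1) * Z t - Z t * ((X t)ᵀ * X t - 1) := by
      rw [Matrix.transpose_mul, hZ, Matrix.sub_mul, Matrix.mul_sub, Matrix.one_mul, Matrix.mul_one,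
        Matrix.neg_mul, Matrix.neg_mul, Matrix.mul_assoc, Matrix.mul_assoc]
      abel
    rw [h2, frobInner_commutator_eq_zero (hZ t), mul_zero]
  have hanti : AntitoneOn (fun s => ‖(X s)ᵀ * X s - 1‖ ^ 2) (Set.Ici 0) :=
    antitoneOn_of_hasDerivWithinAt_nonpos (convex_Ici 0) (f' := fun _ => 0)
      (fun t ht => (hderiv t ht).continuousWithinAt)
      (fun t ht => (hderiv t (interior_subset ht)).mono interior_subset) (fun _ _ => le_rfl)
  have h1 := hanti (Set.self_mem_Ici (a := (0 : ℝ))) ht ht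
  simp only [h0, sub_self, norm_zero] at h1
  have h2 : ‖(X t)ᵀ * X t - 1‖ = 0 := by
    have := norm_nonneg ((X t)ᵀ * X t - 1)
    nlinarith
  exact sub_eq_zero.1 (norm_eq_zero.1 h2)

/-- The determinant is continuous in time with values `±1`, so it cannot leave `1`. -/
theorem det_eq_one_of_continuousOn {X : ℝ → Matrix (Fin n) (Fin n) ℝ}
    (hX : ∀ a b, ContinuousOn (fun s => X s a b) (Set.Ici 0))
    (hort : ∀ t, 0 ≤ t → (X t)ᵀ * X t = 1) (h0 : (X 0).det = 1) {t : ℝ} (ht : 0 ≤ t) :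
    (X t).det = 1 := by
  have hsq : ∀ s, 0 ≤ s → (X s).det * (X s).det = 1 := fun s hs => by
    have := congrArg Matrix.det (hort s hs)
    rwa [Matrix.det_mul, Matrix.det_transpose, Matrix.det_one] at this
  have hcont : ContinuousOn (fun s => (X s).det) (Set.Ici 0) := by
    simp only [Matrix.det_apply]
    exact continuousOn_finsetSum _ fun σ _ =>
      (continuousOn_finsetProd _ fun i _ => hX _ _).const_smul _
  rcases mul_self_eq_one_iff.1 (hsq t ht) with h | h
  · exact h
  · obtain ⟨s, hs, hs0⟩ := isPreconnected_Ici.intermediate_value (Set.mem_Ici.2 ht)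
      (Set.self_mem_Ici (a := (0 : ℝ))) hcont (show (0 : ℝ) ∈ Set.Icc _ _ by
        rw [h, h0]
        norm_num)
    have := hsq s hs
    simp only at hs0
    rw [hs0] at this
    norm_num at this

/-- The cut-off multiplies the body velocity by a scalar and so keeps it skew. The cut-off
trajectory therefore stays in `SO(n)^k`, which lies in the unit ball of the sup norm, where the
cut-off equals `1`. -/
theorem exists_isSolution {k : ℕ} (G : SimpleGraph (Fin k)) [DecidableRel G.Adj]
    (y : Fin k → Fin k → EuclideanSpace ℝ (Fin n)) (Q₀ : State k n) :
    ∃ Q : ℝ → State k n, IsSolution G y Q ∧ Q 0 = Q₀ := by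
  obtain ⟨χ, hχ, γ, hγ0, hγ⟩ := exists_forward_solution_cutoff (contDiff_ambientField G y)
    (fun i => (Q₀ i).1)
  have hentry : ∀ t, 0 ≤ t → ∀ i a b, HasDerivWithinAt (fun s => γ s i a b)
      (χ (γ t) * (Matrix.of (γ t i) * ambientVelocity G y (γ t) i) a b) (Set.Ici 0) t :=
    fun t ht i a b =>
      hasDerivWithinAt_pi.1 (hasDerivWithinAt_pi.1 (hasDerivWithinAt_pi.1 (hγ t ht) i) a) b
  have hskew : ∀ t i, (χ (γ t) • ambientVelocity G y (γ t) i)ᵀ =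
      -(χ (γ t) • ambientVelocity G y (γ t) i) := fun t i => by
    rw [Matrix.transpose_smul, ambientVelocity, Matrix.transpose_sum]
    simp only [transpose_sk, Finset.sum_neg_distrib, smul_neg]
  have hort : ∀ i t, 0 ≤ t → (Matrix.of (γ t i))ᵀ * Matrix.of (γ t i) = 1 := fun i t ht => by
    refine transpose_mul_self_eq_one_of_deriv (X := fun t => Matrix.of (γ t i))
      (fun t => hskew t i) (fun t ht a b => ?_) ?_ ht
    · rw [Matrix.mul_smul]
      exact hentry t ht i a b
    · rw [hγ0]
      exact SO.transpose_mul_self (Q₀ i)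
  have hdet : ∀ i t, 0 ≤ t → (Matrix.of (γ t i)).det = 1 := fun i t ht => by
    refine det_eq_one_of_continuousOn (X := fun t => Matrix.of (γ t i))
      (fun a b s hs => (hentry s hs i a b).continuousWithinAt) (hort i) ?_ ht
    rw [hγ0]
    exact SO.det_eq_one (Q₀ i)
  let Q : ℝ → State k n := fun t => if ht : 0 ≤ t then
    fun i => ⟨Matrix.of (γ t i), Matrix.mem_specialOrthogonalGroup_iff.2
      ⟨(Matrix.mem_orthogonalGroup_iff' _ _).2 (hort i t ht), hdet i t ht⟩⟩ else Q₀
  have hQ : ∀ t, 0 ≤ t → ∀ i, (Q t i).1 = Matrix.of (γ t i) := fun t ht i => by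
    simp only [Q, dif_pos ht]
  refine ⟨Q, fun t ht i a b => ?_, funext fun i => Subtype.ext ?_⟩
  · have hχ1 : χ (γ t) = 1 := by
      refine hχ _ ((pi_norm_le_iff_of_nonneg zero_le_one).2 fun i =>
        (pi_norm_le_iff_of_nonneg zero_le_one).2 fun a =>
        (pi_norm_le_iff_of_nonneg zero_le_one).2 fun b => ?_)
      have := SO.abs_entry_le_one (Q t i) a b
      rwa [hQ t ht] at this
    have h1 := hentry t ht i a b
    rw [hχ1, one_mul] at h1
    have h2 : couplingField G y (Q t) i = Matrix.of (γ t i) * ambientVelocity G y (γ t) i := by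
      simp only [couplingField, ambientVelocity, hQ t ht]
    rw [h2]
    refine h1.congr (fun s hs => ?_) ?_
    · rw [hQ s hs]
      rfl
    · rw [hQ t ht]
      rfl
  · rw [hQ 0 le_rfl, hγ0]
    rfl

end Existence

end PartialSync
end

noncomputable section
namespace PartialSync

/-! ### Rigidity from exponential stability -/

section Exponential

attribute [local instance] Matrix.frobeniusNormedAddCommGroup Matrix.frobeniusNormedSpace
  Matrix.frobeniusNormedRing Matrix.frobeniusNormedAlgebra

open NormedSpace

variable {n : ℕ}

theorem transpose_mul_exp_of_skew {A : Matrix (Fin n) (Fin n) ℝ} (hA : Aᵀ = -A) :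
    (exp A)ᵀ * exp A = 1 := by
  rw [← Matrix.exp_transpose, hA, ← Matrix.exp_add_of_commute _ _
      ((Commute.refl A).neg_left), neg_add_cancel, exp_zero]

/-- Writing `exp A` as the square of `exp (A/2)` makes its determinant the square of an orthogonal
determinant, which excludes `-1`. -/
theorem det_exp_of_skew {A : Matrix (Fin n) (Fin n) ℝ} (hA : Aᵀ = -A) : (exp A).det = 1 := by
  have hhalf : ((1 / 2 : ℝ) • A)ᵀ = -((1 / 2 : ℝ) • A) := by
    rw [Matrix.transpose_smul, hA, smul_neg]
  have h1 : exp A = exp ((1 / 2 : ℝ) • A) * exp ((1 / 2 : ℝ) • A) := by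
    rw [← Matrix.exp_add_of_commute _ _ rfl, ← add_smul]
    norm_num
  have h2 := congrArg Matrix.det (transpose_mul_exp_of_skew hhalf)
  rw [Matrix.det_mul, Matrix.det_transpose, Matrix.det_one] at h2
  rw [h1, Matrix.det_mul, h2]

/-- The rotation `exp A` for a skew-symmetric matrix `A`. -/
def expSO (A : Matrix (Fin n) (Fin n) ℝ) (hA : Aᵀ = -A) : SO n :=
  ⟨exp A, Matrix.mem_specialOrthogonalGroup_iff.2
    ⟨(Matrix.mem_orthogonalGroup_iff' _ _).2 (transpose_mul_exp_of_skew hA), det_exp_of_skew hA⟩⟩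

theorem tendsto_exp_smul_sub (A B : Matrix (Fin n) (Fin n) ℝ) :
    Filter.Tendsto (fun t : ℝ => t⁻¹ • (exp (t • A) - exp (t • B)))
      (nhdsWithin 0 {0}ᶜ) (nhds (A - B)) := by
  have h : ∀ A : Matrix (Fin n) (Fin n) ℝ,
      HasDerivAt (fun t : ℝ => exp (t • A)) A 0 := fun A => by
    have := hasDerivAt_exp_smul_const (𝕂 := ℝ) A (0 : ℝ)
    simp only [zero_smul, exp_zero, one_mul] at this
    exact this
  have h1 := ((h A).sub (h B)).tendsto_slope_zero
  simp only [zero_add, zero_smul, sub_self, sub_zero, Pi.sub_apply] at h1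
  exact h1

end Exponential

section Necessity

attribute [local instance] Matrix.frobeniusNormedAddCommGroup Matrix.frobeniusNormedSpace

variable {k n : ℕ} {G : SimpleGraph (Fin k)} [DecidableRel G.Adj]
  {y : Fin k → Fin k → EuclideanSpace ℝ (Fin n)}

theorem dist_stateVec_le_of_entries {Q P : State k n} {B : ℝ} (hB : 0 ≤ B)
    (h : ∀ i a b, |(Q i).1 a b - (P i).1 a b| ≤ B) :
    dist (stateVec Q) (stateVec P) ≤ √(k * (n * n)) * B := by
  have h1 : dist (stateVec Q) (stateVec P) ^ 2 ≤ k * (n * n) * B ^ 2 := by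
    rw [dist_stateVec_sq]
    simp only [norm_sq_eq_sum]
    have h2 : ∀ i a b, ((Q i).1 - (P i).1) a b ^ 2 ≤ B ^ 2 := fun i a b => by
      rw [← sq_abs]
      exact pow_le_pow_left₀ (abs_nonneg _) (h i a b) 2
    refine (Finset.sum_le_sum fun i _ => Finset.sum_le_sum fun a _ =>
      Finset.sum_le_sum fun b _ => h2 i a b).trans (le_of_eq ?_)
    simp
    ring
  refine le_of_sq_le_sq ?_ (by positivity)
  rw [mul_pow, Real.sq_sqrt (by positivity)]
  exact h1

/-- Exponential stability implies an error bound for the synchronization distance. -/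
theorem LocallyExponentiallyStable.exists_error_bound (hy : IsReference G y)
    (h : LocallyExponentiallyStable G y (stateSync k n)) :
    ∃ δ, 0 < δ ∧ ∃ C, 0 ≤ C ∧ ∀ Q : State k n, distTo (stateSync k n) Q < δ →
      distTo (stateSync k n) Q ≤ C * √(edgeEnergy G y Q) := by
  obtain ⟨δ, hδ, c, hc, r, hr, hstab⟩ := h
  -- At this time `c e^(-rT) = c e^(-2c) ≤ 1/2`, because `e^(2c) ≥ 1 + 2c`; the distance has at
  -- least halved.
  set T : ℝ := 2 * c / r with hT
  have hT0 : 0 ≤ T := by positivity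
  refine ⟨δ, hδ, 2 * (√(k * (n * n)) * (k * T)), by positivity, fun Q₀ hQ₀ => ?_⟩
  obtain ⟨Q, hQ, rfl⟩ := exists_isSolution G y Q₀
  have h1 := hstab Q hQ hQ₀ T hT0
  have h2 : c * Real.exp (-r * T) ≤ 1 / 2 := by
    have h3 : -r * T = -(2 * c) := by
      rw [hT]
      field_simp
    have h4 := Real.add_one_le_exp (2 * c)
    rw [h3, Real.exp_neg, ← div_eq_mul_inv, div_le_iff₀ (Real.exp_pos _)]
    linarith
  have h3 := Metric.infDist_le_infDist_add_dist (s := stateVec '' stateSync k n)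
    (x := stateVec (Q 0)) (y := stateVec (Q T))
  have h4 := dist_stateVec_le_of_entries (Q := Q T) (P := Q 0)
    (B := k * √(edgeEnergy G y (Q 0)) * T) (by positivity)
    (fun i a b => hQ.abs_sub_entry_le hy hT0 i a b)
  rw [dist_comm] at h4
  have h5 := mul_le_mul_of_nonneg_right h2 (distTo_nonneg (stateSync k n) (Q 0))
  have h6 : distTo (stateSync k n) (Q 0) ≤ distTo (stateSync k n) (Q T) +
    dist (stateVec (Q 0)) (stateVec (Q T)) := h3
  linarith

/-- The error bound is evaluated along `exp (t Ω_i)` and divided by `|t|`. In the limit its right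
side becomes the edge energy of `Ω`, which vanishes, while its left side tends to `‖Ω_i - Ω_j‖`. -/
theorem LocallyExponentiallyStable.infRigid (hk : 1 ≤ k) (hy : IsReference G y)
    (h : LocallyExponentiallyStable G y (stateSync k n)) : InfRigid G y := by
  obtain ⟨δ, hδ, C, hC, hle⟩ := h.exists_error_bound hy
  intro Ω hΩ hM i j
  have hskew : ∀ (t : ℝ) i, (t • Ω i)ᵀ = -(t • Ω i) := fun t i => by
    rw [Matrix.transpose_smul, hΩ, smul_neg]
  let Q : ℝ → State k n := fun t i => expSO (t • Ω i) (hskew t i)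
  have hlim : ∀ i j, Filter.Tendsto (fun t : ℝ => t⁻¹ • ((Q t i).1 - (Q t j).1))
      (nhdsWithin 0 {0}ᶜ) (nhds (Ω i - Ω j)) := fun i j => tendsto_exp_smul_sub _ _
  have hquot : ∀ t i j, t ≠ 0 → (Q t i).1 - (Q t j).1 = t • t⁻¹ • ((Q t i).1 - (Q t j).1) :=
    fun t i j ht => by rw [smul_inv_smul₀ ht]
  have hid : Filter.Tendsto (fun t : ℝ => t) (nhdsWithin 0 {0}ᶜ) (nhds 0) :=
    Filter.tendsto_id.mono_left nhdsWithin_le_nhds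
  have hne : ∀ᶠ t : ℝ in nhdsWithin 0 {0}ᶜ, t ≠ 0 := self_mem_nhdsWithin
  have hspread : Filter.Tendsto (fun t => spread (Q t)) (nhdsWithin 0 {0}ᶜ) (nhds 0) := by
    have h0 : ∀ i j, Filter.Tendsto (fun t => ‖(Q t i).1 - (Q t j).1‖ ^ 2)
        (nhdsWithin 0 {0}ᶜ) (nhds 0) := fun i j => by
      have h1 := ((hid.smul (hlim i j)).norm).pow 2
      rw [zero_smul, norm_zero, zero_pow two_ne_zero] at h1
      refine h1.congr' ?_
      filter_upwards [hne] with t ht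
      rw [← hquot t i j ht]
    have h1 := tendsto_finsetSum Finset.univ fun i (_ : i ∈ Finset.univ) =>
      tendsto_finsetSum Finset.univ fun j (_ : j ∈ Finset.univ) => h0 i j
    simp only [Finset.sum_const_zero] at h1
    exact h1
  have hclose : ∀ᶠ t in nhdsWithin (0 : ℝ) {0}ᶜ, distTo (stateSync k n) (Q t) < δ := by
    have h1 := hspread.sqrt
    rw [Real.sqrt_zero] at h1
    filter_upwards [h1.eventually (gt_mem_nhds hδ)] with t ht
    exact (distTo_stateSync_le hk _).trans_lt ht
  have henergy : Filter.Tendsto (fun t => ∑ i, ∑ j ∈ G.neighborFinset i,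
      ‖proj (y i j) * (t⁻¹ • ((Q t i).1 - (Q t j).1))‖ ^ 2) (nhdsWithin 0 {0}ᶜ) (nhds 0) := by
    have h0 : ∀ i, ∀ j ∈ G.neighborFinset i, Filter.Tendsto
        (fun t => ‖proj (y i j) * (t⁻¹ • ((Q t i).1 - (Q t j).1))‖ ^ 2)
        (nhdsWithin 0 {0}ᶜ) (nhds 0) := fun i j hj => by
      have h1 := (((continuous_const (y := proj (y i j))).matrix_mul continuous_id).tendsto
        (Ω i - Ω j)).comp (hlim i j)
      have h2 := h1.norm.pow 2
      have h3 : proj (y i j) * id (Ω i - Ω j) = 0 := hM i j (by simpa using hj)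
      rw [h3, norm_zero, zero_pow two_ne_zero] at h2
      exact h2
    have h1 := tendsto_finsetSum Finset.univ fun i (_ : i ∈ Finset.univ) =>
      tendsto_finsetSum (G.neighborFinset i) fun j hj => h0 i j hj
    simpa using h1
  have hbound : ∀ᶠ t in nhdsWithin (0 : ℝ) {0}ᶜ, ‖t⁻¹ • ((Q t i).1 - (Q t j).1)‖ ≤
      2 * C * √(∑ i, ∑ j ∈ G.neighborFinset i,
        ‖proj (y i j) * (t⁻¹ • ((Q t i).1 - (Q t j).1))‖ ^ 2) := by
    filter_upwards [hclose] with t ht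
    have h1 := norm_sub_le_distTo (Q t) i j
    have h2 := hle (Q t) ht
    have h3 : √(∑ i, ∑ j ∈ G.neighborFinset i,
        ‖proj (y i j) * (t⁻¹ • ((Q t i).1 - (Q t j).1))‖ ^ 2) =
        ‖t⁻¹‖ * √(edgeEnergy G y (Q t)) := by
      rw [← Real.sqrt_sq (norm_nonneg t⁻¹), ← Real.sqrt_mul (by positivity), edgeEnergy]
      simp only [Matrix.mul_smul, norm_smul, mul_pow, Finset.mul_sum]
    rw [h3, norm_smul]
    have h4 := mul_le_mul_of_nonneg_left (h1.trans (mul_le_mul_of_nonneg_left h2 zero_le_two))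
      (norm_nonneg t⁻¹)
    linarith
  have hfin := le_of_tendsto_of_tendsto (hlim i j).norm ((henergy.sqrt).const_mul (2 * C)) hbound
  rw [Real.sqrt_zero, mul_zero] at hfin
  exact sub_eq_zero.1 (norm_le_zero_iff.1 hfin)

end Necessity

end PartialSync
end

noncomputable section
namespace PartialSync

/-! ### Asymptotic stability from isolated equilibria -/

section LaSalle

attribute [local instance] Matrix.frobeniusNormedAddCommGroup Matrix.frobeniusNormedSpace

variable {k n : ℕ} {G : SimpleGraph (Fin k)} [DecidableRel G.Adj]
  {y : Fin k → Fin k → EuclideanSpace ℝ (Fin n)}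

instance SO.instCompactSpace : CompactSpace (SO n) := by
  refine isCompact_iff_compactSpace.1 ?_
  have hbox : IsCompact {X : Matrix (Fin n) (Fin n) ℝ | ∀ a b, X a b ∈ Set.Icc (-1 : ℝ) 1} := by
    have h := isCompact_univ_pi fun _ : Fin n => isCompact_univ_pi fun _ : Fin n =>
      isCompact_Icc (a := (-1 : ℝ)) (b := 1)
    have heq : {X : Matrix (Fin n) (Fin n) ℝ | ∀ a b, X a b ∈ Set.Icc (-1 : ℝ) 1} =
        (Set.univ.pi fun _ : Fin n => Set.univ.pi fun _ : Fin n => Set.Icc (-1 : ℝ) 1) :=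
      Set.ext fun X => ⟨fun h a _ b _ => h a b, fun h a b => h a trivial b trivial⟩
    rw [heq]
    exact h
  refine hbox.of_isClosed_subset ?_ fun X hX a b => abs_le.1 (SO.abs_entry_le_one ⟨X, hX⟩ a b)
  have h : (SetLike.coe (Matrix.specialOrthogonalGroup (Fin n) ℝ)) =
      {X : Matrix (Fin n) (Fin n) ℝ | Xᵀ * X = 1} ∩ {X | X.det = 1} := by
    ext X
    exact Matrix.mem_specialOrthogonalGroup_iff.trans
      (and_congr_left' (Matrix.mem_orthogonalGroup_iff' _ _))
  rw [h]
  refine IsClosed.inter (isClosed_eq ?_ continuous_const) (isClosed_eq ?_ continuous_const)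
  · exact continuous_id.matrix_transpose.matrix_mul continuous_id
  · exact continuous_id.matrix_det

theorem continuous_coe (i : Fin k) : Continuous fun Q : State k n => (Q i).1 :=
  continuous_subtype_val.comp (continuous_apply i)

theorem continuous_spread : Continuous (spread : State k n → ℝ) :=
  continuous_finsetSum _ fun i _ => continuous_finsetSum _ fun j _ =>
    ((continuous_coe i).sub (continuous_coe j)).norm.pow 2

theorem continuous_edgeEnergy : Continuous (edgeEnergy G y : State k n → ℝ) :=
  continuous_finsetSum _ fun i _ => continuous_finsetSum _ fun j _ =>
    (continuous_const.matrix_mul ((continuous_coe i).sub (continuous_coe j))).norm.pow 2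

theorem continuous_bodyVelocity (i : Fin k) :
    Continuous fun Q : State k n => bodyVelocity G y Q i := by
  refine continuous_finsetSum _ fun j _ => ?_
  have h : Continuous fun Q : State k n => (Q i).1ᵀ * proj (y i j) * (Q j).1 :=
    ((continuous_coe i).matrix_transpose.matrix_mul continuous_const).matrix_mul (continuous_coe j)
  exact (h.sub h.matrix_transpose).const_smul (1 / 2 : ℝ)

theorem exists_pos_le_of_pos_on_shell {f : State k n → ℝ} (hf : Continuous f) (a b : ℝ)
    (hpos : ∀ Q, a ≤ spread Q → spread Q ≤ b → 0 < f Q) :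
    ∃ m, 0 < m ∧ ∀ Q, a ≤ spread Q → spread Q ≤ b → m ≤ f Q := by
  have hK : IsCompact {Q : State k n | a ≤ spread Q ∧ spread Q ≤ b} :=
    ((isClosed_le continuous_const continuous_spread).inter
      (isClosed_le continuous_spread continuous_const)).isCompact
  rcases Set.eq_empty_or_nonempty {Q : State k n | a ≤ spread Q ∧ spread Q ≤ b} with he | hne
  · exact ⟨1, one_pos, fun Q h1 h2 => absurd (show Q ∈ (∅ : Set (State k n)) from he ▸ ⟨h1, h2⟩)
      (Set.notMem_empty Q)⟩
  · obtain ⟨Q₀, hQ₀, hmin⟩ := hK.exists_isMinOn hne hf.continuousOn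
    exact ⟨f Q₀, hpos Q₀ hQ₀.1 hQ₀.2, fun Q h1 h2 => hmin ⟨h1, h2⟩⟩

theorem edgeEnergy_le_spread (hy : IsReference G y) (Q : State k n) :
    edgeEnergy G y Q ≤ spread Q := by
  refine Finset.sum_le_sum fun i _ => (Finset.sum_le_sum fun j hj => ?_).trans
    (Finset.sum_le_sum_of_subset_of_nonneg (Finset.subset_univ _) fun _ _ _ => sq_nonneg _)
  refine pow_le_pow_left₀ (norm_nonneg _) ((Matrix.frobenius_norm_mul _ _).trans ?_) 2
  rw [norm_proj, hy.unit i j (by simpa using hj), one_pow, one_mul]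

theorem bodyVelocity_eq_zero_of_edgeEnergy {Q : State k n} (h : edgeEnergy G y Q = 0)
    (i : Fin k) : bodyVelocity G y Q i = 0 := by
  have := norm_bodyVelocity_le (G := G) (y := y) Q i
  rw [h, Real.sqrt_zero, mul_zero] at this
  exact norm_le_zero_iff.1 this

/-- Near the synchronization set there are no further equilibria. -/
def IsolatedEquilibria (G : SimpleGraph (Fin k)) [DecidableRel G.Adj]
    (y : Fin k → Fin k → EuclideanSpace ℝ (Fin n)) (ε : ℝ) : Prop :=
  ∀ Q : State k n, spread Q ≤ ε → (∀ i, bodyVelocity G y Q i = 0) → spread Q = 0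

/-- On the compact level set `V = ε` the energy `W` has a positive minimum `m`, since a zero of `W`
would be an equilibrium. As `W ≤ V`, starting with `V < m` and with `W` nonincreasing, that level
cannot be reached. -/
theorem IsolatedEquilibria.exists_trapping (hy : IsReference G y) {ε₀ : ℝ}
    (hiso : IsolatedEquilibria G y ε₀) {ε : ℝ} (hε : 0 < ε) (hle : ε ≤ ε₀) :
    ∃ δ, 0 < δ ∧ ∀ Q : ℝ → State k n, IsSolution G y Q → ∀ s, 0 ≤ s → spread (Q s) < δ →
      ∀ t, s ≤ t → spread (Q t) < ε := by
  obtain ⟨m, hm, hmin⟩ := exists_pos_le_of_pos_on_shell (continuous_edgeEnergy (G := G) (y := y))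
    ε ε fun Q h1 h2 => by
      refine lt_of_le_of_ne (edgeEnergy_nonneg Q) fun h0 => ?_
      have := hiso Q (h2.trans hle) (bodyVelocity_eq_zero_of_edgeEnergy h0.symm)
      linarith
  refine ⟨min ε m, lt_min hε hm, fun Q hQ s hs hlt t hst => ?_⟩
  by_contra! hcon
  obtain ⟨u, hu, hue⟩ := intermediate_value_Icc hst
    (hQ.continuousOn_spread.mono fun x hx => hs.trans hx.1)
    ⟨(hlt.trans_le (min_le_left _ _)).le, hcon⟩
  have h1 := hmin (Q u) hue.ge hue.le
  have h2 := hQ.antitoneOn_edgeEnergy hy (Set.mem_Ici.2 hs) (Set.mem_Ici.2 (hs.trans hu.1)) hu.1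
  have h3 := edgeEnergy_le_spread hy (Q s)
  have h4 := hlt.trans_le (min_le_right _ _)
  simp only at h2
  linarith

/-- If `V` stayed in `[ε, ε₀]`, compactness would bound the squared speed below by some `m > 0`, and
`W` would decrease at rate at least `4 m` until it became negative. Together with trapping, one such
time suffices for convergence. -/
theorem IsolatedEquilibria.exists_spread_lt (hy : IsReference G y) {ε₀ : ℝ}
    (hiso : IsolatedEquilibria G y ε₀) {Q : ℝ → State k n} (hQ : IsSolution G y Q)
    (hsmall : ∀ t, 0 ≤ t → spread (Q t) ≤ ε₀) {ε : ℝ} (hε : 0 < ε) :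
    ∃ t, 0 ≤ t ∧ spread (Q t) < ε := by
  by_contra! hcon
  obtain ⟨m, hm, hmin⟩ := exists_pos_le_of_pos_on_shell
    (f := fun Q : State k n => ∑ i, ‖bodyVelocity G y Q i‖ ^ 2)
    (continuous_finsetSum _ fun i _ => (continuous_bodyVelocity i).norm.pow 2) ε ε₀
    fun Q h1 h2 => by
      refine lt_of_le_of_ne (Finset.sum_nonneg fun _ _ => sq_nonneg _) fun h0 => ?_
      have h3 := (Finset.sum_eq_zero_iff_of_nonneg fun i _ =>
        sq_nonneg ‖bodyVelocity G y Q i‖).1 h0.symm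
      have := hiso Q h2 fun i => by simpa using h3 i (Finset.mem_univ i)
      linarith
  have hanti : AntitoneOn (fun t => edgeEnergy G y (Q t) + 4 * m * t) (Set.Ici 0) := by
    have hd : ∀ t, 0 ≤ t → HasDerivWithinAt (fun t => edgeEnergy G y (Q t) + 4 * m * t)
        (-4 * ∑ i, ‖bodyVelocity G y (Q t) i‖ ^ 2 + 4 * m) (Set.Ici 0) t := fun t ht => by
      refine (hQ.hasDerivWithinAt_edgeEnergy hy ht).add ?_
      simpa using (hasDerivWithinAt_id t (Set.Ici 0)).const_mul (4 * m)
    refine antitoneOn_of_hasDerivWithinAt_nonpos (convex_Ici 0)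
      (fun t ht => (hd t ht).continuousWithinAt)
      (fun t ht => (hd t (interior_subset ht)).mono interior_subset) fun t ht => ?_
    have ht0 : 0 ≤ t := interior_subset ht
    have := hmin (Q t) (hcon t ht0) (hsmall t ht0)
    linarith
  have hT : 0 ≤ (edgeEnergy G y (Q 0) + 1) / (4 * m) := by
    have := edgeEnergy_nonneg (G := G) (y := y) (Q 0)
    positivity
  have h1 := hanti (Set.self_mem_Ici (a := (0 : ℝ))) hT hT
  have h2 : 4 * m * ((edgeEnergy G y (Q 0) + 1) / (4 * m)) = edgeEnergy G y (Q 0) + 1 := by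
    field_simp
  simp only [h2] at h1
  have h3 := edgeEnergy_nonneg (G := G) (y := y) (Q ((edgeEnergy G y (Q 0) + 1) / (4 * m)))
  linarith

/-- LaSalle's principle at the synchronization set. -/
theorem IsolatedEquilibria.locallyAsymptoticallyStable (hk : 1 ≤ k) (hy : IsReference G y)
    {ε₀ : ℝ} (hε₀ : 0 < ε₀) (hiso : IsolatedEquilibria G y ε₀) :
    LocallyAsymptoticallyStable G y (stateSync k n) := by
  have hkpos : (0 : ℝ) < k := by exact_mod_cast hk
  have hclose : ∀ δ, 0 < δ → ∃ η, 0 < η ∧ ∀ Q : State k n, distTo (stateSync k n) Q < η →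
      spread Q < δ := fun δ hδ => by
    refine ⟨√δ / (2 * k), by positivity, fun Q hQ => ?_⟩
    rw [lt_div_iff₀ (by positivity)] at hQ
    refine (Real.sqrt_lt_sqrt_iff (spread_nonneg _)).1 ((sqrt_spread_le_distTo Q).trans_lt ?_)
    linarith
  refine ⟨fun ε hε => ?_, ?_⟩
  · obtain ⟨δ, hδ, htrap⟩ := hiso.exists_trapping hy
      (lt_min (pow_pos hε 2) hε₀) (min_le_right (ε ^ 2) ε₀)
    obtain ⟨η, hη, hd⟩ := hclose δ hδ
    refine ⟨η, hη, fun Q hQ hQ0 t ht => (distTo_stateSync_le hk _).trans_lt ?_⟩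
    rw [Real.sqrt_lt' hε]
    exact (htrap Q hQ 0 le_rfl (hd _ hQ0) t ht).trans_le (min_le_left _ _)
  · obtain ⟨δ, hδ, htrap⟩ := hiso.exists_trapping hy hε₀ le_rfl
    obtain ⟨η, hη, hd⟩ := hclose δ hδ
    refine ⟨η, hη, fun Q hQ hQ0 => Metric.tendsto_atTop.2 fun ε hε => ?_⟩
    obtain ⟨δ', hδ', htrap'⟩ := hiso.exists_trapping hy
      (lt_min (pow_pos hε 2) hε₀) (min_le_right (ε ^ 2) ε₀)
    obtain ⟨T, hT, hlt⟩ := hiso.exists_spread_lt hy hQ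
      (fun t ht => (htrap Q hQ 0 le_rfl (hd _ hQ0) t ht).le) hδ'
    refine ⟨T, fun t ht => ?_⟩
    rw [Real.dist_0_eq_abs, abs_of_nonneg (distTo_nonneg _ _)]
    refine (distTo_stateSync_le hk _).trans_lt ?_
    rw [Real.sqrt_lt' hε]
    exact (htrap' Q hQ T hT hlt t ht).trans_le (min_le_left _ _)

end LaSalle

end PartialSync
end

noncomputable section
namespace PartialSync

/-! ### Equilibria of a triangle with coplanar axes -/

section Triangle

attribute [local instance] Matrix.frobeniusNormedAddCommGroup Matrix.frobeniusNormedSpace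

/-- The axial vector of a `3 × 3` matrix. -/
def axial (Z : Matrix (Fin 3) (Fin 3) ℝ) : Fin 3 → ℝ := ![Z 2 1, Z 0 2, Z 1 0]

theorem transpose_mul_proj_mul {n : ℕ} (P R : Matrix (Fin n) (Fin n) ℝ)
    (y : EuclideanSpace ℝ (Fin n)) :
    Pᵀ * proj y * R = Matrix.vecMulVec (Pᵀ *ᵥ y.ofLp) (Rᵀ *ᵥ y.ofLp) := by
  have h : proj y = Matrix.vecMulVec y.ofLp y.ofLp := rfl
  rw [h, Matrix.mul_vecMulVec, Matrix.vecMulVec_mul, Matrix.mulVec_transpose R]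

/-- The axial vector of `sk(u vᵀ)` is `-(u × v) / 2`, hence orthogonal to both factors. -/
theorem dotProduct_axial_left (u v : Fin 3 → ℝ) :
    u ⬝ᵥ axial (sk (Matrix.vecMulVec u v)) = 0 := by
  simp [axial, sk, dotProduct, Fin.sum_univ_three, Matrix.vecMulVec_apply]
  ring

theorem dotProduct_axial_right (u v : Fin 3 → ℝ) :
    v ⬝ᵥ axial (sk (Matrix.vecMulVec u v)) = 0 := by
  simp [axial, sk, dotProduct, Fin.sum_univ_three, Matrix.vecMulVec_apply]
  ring

/-- Lagrange's identity: for unit vectors this is half the squared sine of their angle, so the size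
of an edge term determines the cosine up to sign. -/
theorem norm_sk_vecMulVec_sq {n : ℕ} (u v : Fin n → ℝ) :
    ‖sk (Matrix.vecMulVec u v)‖ ^ 2 = 1 / 2 * ((u ⬝ᵥ u) * (v ⬝ᵥ v) - (u ⬝ᵥ v) ^ 2) := by
  have h : ∀ a b, sk (Matrix.vecMulVec u v) a b ^ 2 =
      1 / 4 * (u a * u a * (v b * v b)) + 1 / 4 * (v a * v a * (u b * u b)) -
        1 / 2 * (u a * v a * (u b * v b)) := fun a b => by
    simp [sk, Matrix.vecMulVec_apply]
    ring
  rw [norm_sq_eq_sum]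
  simp only [h, Finset.sum_add_distrib, Finset.sum_sub_distrib, ← Finset.mul_sum,
    ← Finset.sum_mul]
  simp only [dotProduct]
  ring

theorem dotProduct_transpose_mulVec_self {n : ℕ} (P : SO n) (y : Fin n → ℝ) :
    (P.1ᵀ *ᵥ y) ⬝ᵥ (P.1ᵀ *ᵥ y) = y ⬝ᵥ y := by
  rw [Matrix.dotProduct_mulVec, Matrix.vecMul_transpose, Matrix.mulVec_mulVec,
    SO.mul_transpose_self, Matrix.one_mulVec]

theorem dotProduct_transpose_mulVec {n : ℕ} (P R : SO n) (y : Fin n → ℝ) :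
    (P.1ᵀ *ᵥ y) ⬝ᵥ (R.1ᵀ *ᵥ y) = y ⬝ᵥ ((P.1 * R.1ᵀ) *ᵥ y) := by
  rw [Matrix.mulVec_transpose P.1, ← Matrix.dotProduct_mulVec, Matrix.mulVec_mulVec]

theorem dotProduct_self_eq_one {n : ℕ} {y : EuclideanSpace ℝ (Fin n)} (hy : ‖y‖ = 1) :
    y.ofLp ⬝ᵥ y.ofLp = 1 := by
  have h := EuclideanSpace.real_norm_sq_eq y
  rw [hy, one_pow] at h
  rw [h, dotProduct]
  exact Finset.sum_congr rfl fun a _ => by ring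

theorem norm_sk_edge_sq {n : ℕ} (P R : SO n) {y : EuclideanSpace ℝ (Fin n)} (hy : ‖y‖ = 1) :
    ‖sk (P.1ᵀ * proj y * R.1)‖ ^ 2 =
      1 / 2 * (1 - (y.ofLp ⬝ᵥ ((P.1 * R.1ᵀ) *ᵥ y.ofLp)) ^ 2) := by
  rw [transpose_mul_proj_mul, norm_sk_vecMulVec_sq, dotProduct_transpose_mulVec_self,
    dotProduct_transpose_mulVec_self, dotProduct_transpose_mulVec, dotProduct_self_eq_one hy,
    one_mul]

theorem dotProduct_mulVec_axial_left (P R : SO 3) (y : EuclideanSpace ℝ (Fin 3)) :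
    y.ofLp ⬝ᵥ (P.1 *ᵥ axial (sk (P.1ᵀ * proj y * R.1))) = 0 := by
  rw [transpose_mul_proj_mul, Matrix.dotProduct_mulVec, ← Matrix.mulVec_transpose]
  exact dotProduct_axial_left _ _

theorem dotProduct_mulVec_axial_right (P R : SO 3) (y : EuclideanSpace ℝ (Fin 3)) :
    y.ofLp ⬝ᵥ (R.1 *ᵥ axial (sk (P.1ᵀ * proj y * R.1))) = 0 := by
  rw [transpose_mul_proj_mul, Matrix.dotProduct_mulVec, ← Matrix.mulVec_transpose]
  exact dotProduct_axial_right _ _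

theorem transpose_mulVec_eq_of_dotProduct {n : ℕ} (P R : SO n) {y : EuclideanSpace ℝ (Fin n)}
    (hy : ‖y‖ = 1) (h : y.ofLp ⬝ᵥ ((P.1 * R.1ᵀ) *ᵥ y.ofLp) = 1) :
    P.1ᵀ *ᵥ y.ofLp = R.1ᵀ *ᵥ y.ofLp := by
  rw [← sub_eq_zero, ← dotProduct_self_eq_zero, sub_dotProduct, dotProduct_sub, dotProduct_sub,
    dotProduct_transpose_mulVec_self, dotProduct_transpose_mulVec_self,
    dotProduct_comm (R.1ᵀ *ᵥ y.ofLp), dotProduct_transpose_mulVec, h, dotProduct_self_eq_one hy]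
  norm_num

/-- The relative rotation `P Rᵀ`. -/
def relRot {n : ℕ} (P R : SO n) : SO n := P * star R

theorem coe_relRot {n : ℕ} (P R : SO n) : (relRot P R).1 = P.1 * R.1ᵀ := rfl

theorem SO.sum_row_sq {n : ℕ} (A : SO n) (a : Fin n) : ∑ b, A.1 a b ^ 2 = 1 := by
  have h := congrFun (congrFun (SO.mul_transpose_self A) a) a
  rw [Matrix.mul_apply, Matrix.one_apply_eq] at h
  simpa only [Matrix.transpose_apply, ← sq] using h

theorem SO.sum_col_sq {n : ℕ} (A : SO n) (b : Fin n) : ∑ a, A.1 a b ^ 2 = 1 := by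
  have h := congrFun (congrFun (SO.transpose_mul_self A) b) b
  rw [Matrix.mul_apply, Matrix.one_apply_eq] at h
  simpa only [Matrix.transpose_apply, ← sq] using h

theorem eq_zero_of_sum_three_sq {a b c : ℝ} (h : a ^ 2 + b ^ 2 + c ^ 2 = 0) :
    a = 0 ∧ b = 0 ∧ c = 0 := by
  have ha := sq_nonneg a
  have hb := sq_nonneg b
  have hc := sq_nonneg c
  refine ⟨?_, ?_, ?_⟩ <;> refine (pow_eq_zero_iff two_ne_zero).1 ?_ <;> linarith

/-- A rotation fixing the third axis is a planar rotation. -/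
theorem SO.planar_of_axis {A : SO 3} (h0 : A.1 0 2 = 0) (h1 : A.1 1 2 = 0) (h2 : A.1 2 2 = 1) :
    A.1 2 0 = 0 ∧ A.1 2 1 = 0 ∧ A.1 1 1 = A.1 0 0 ∧ A.1 0 1 = -A.1 1 0 ∧
      A.1 0 0 ^ 2 + A.1 1 0 ^ 2 = 1 := by
  have hr2 := SO.sum_row_sq A 2
  have hr0 := SO.sum_row_sq A 0
  have hr1 := SO.sum_row_sq A 1
  have hdet := SO.det_eq_one A
  rw [Matrix.det_fin_three] at hdet
  simp only [Fin.sum_univ_three, h0, h1, h2] at hr0 hr1 hr2 hdet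
  obtain ⟨h20, h21, -⟩ := eq_zero_of_sum_three_sq
    (show A.1 2 0 ^ 2 + A.1 2 1 ^ 2 + 0 ^ 2 = 0 by linarith)
  rw [h20, h21] at hdet
  -- For a `2 × 2` block with unit rows and determinant `1`, this sum of squares is the two row
  -- norms minus twice the determinant, hence `0`.
  obtain ⟨e1, e2, -⟩ := eq_zero_of_sum_three_sq
    (show (A.1 1 1 - A.1 0 0) ^ 2 + (A.1 0 1 + A.1 1 0) ^ 2 + 0 ^ 2 = 0 by
      linear_combination hr0 + hr1 - 2 * hdet)
  replace e1 := sub_eq_zero.1 e1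
  replace e2 := eq_neg_of_add_eq_zero_left e2
  refine ⟨h20, h21, e1, e2, ?_⟩
  rw [e2] at hr0
  linarith

theorem mulVec_apply_of_axis {A : Matrix (Fin 3) (Fin 3) ℝ} {w : Fin 3 → ℝ} (h0 : w 0 = 0)
    (h1 : w 1 = 0) (a : Fin 3) : (A *ᵥ w) a = A a 2 * w 2 := by
  simp [Matrix.mulVec, dotProduct, Fin.sum_univ_three, h0, h1]

/-- If `P` and `R` map a nonzero vector to the third axis and are not far apart, then the relative
rotation fixes the third axis. -/
theorem relRot_axis {P R : SO 3} {z : Fin 3 → ℝ} (hz : z ≠ 0)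
    (hP0 : (P.1 *ᵥ z) 0 = 0) (hP1 : (P.1 *ᵥ z) 1 = 0)
    (hR0 : (R.1 *ᵥ z) 0 = 0) (hR1 : (R.1 *ᵥ z) 1 = 0) (hpos : 0 < (relRot P R).1 2 2) :
    (relRot P R).1 0 2 = 0 ∧ (relRot P R).1 1 2 = 0 ∧ (relRot P R).1 2 2 = 1 := by
  have hmul : (relRot P R).1 *ᵥ (R.1 *ᵥ z) = P.1 *ᵥ z := by
    rw [coe_relRot, Matrix.mulVec_mulVec, Matrix.mul_assoc, SO.transpose_mul_self, Matrix.mul_one]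
  have hc : (R.1 *ᵥ z) 2 ≠ 0 := fun hc => by
    have h0 : R.1 *ᵥ z = 0 := by
      ext a
      fin_cases a
      · exact hR0
      · exact hR1
      · exact hc
    refine hz ?_
    rw [← Matrix.one_mulVec z, ← SO.transpose_mul_self R, ← Matrix.mulVec_mulVec, h0,
      Matrix.mulVec_zero]
  have hrow : ∀ a, (relRot P R).1 a 2 * (R.1 *ᵥ z) 2 = (P.1 *ᵥ z) a := fun a => by
    rw [← hmul, mulVec_apply_of_axis hR0 hR1]
  have h0 : (relRot P R).1 0 2 = 0 := (mul_eq_zero.1 ((hrow 0).trans hP0)).resolve_right hc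
  have h1 : (relRot P R).1 1 2 = 0 := (mul_eq_zero.1 ((hrow 1).trans hP1)).resolve_right hc
  refine ⟨h0, h1, ?_⟩
  -- The third column is now `(0, 0, ±1)`, and positivity of the entry selects the sign.
  have h := SO.sum_col_sq (relRot P R) 2
  rw [Fin.sum_univ_three, h0, h1] at h
  nlinarith

theorem SO.eq_one_of_entries {A : SO 3} (h0 : A.1 0 0 = 1) (h1 : A.1 1 1 = 1) : A.1 = 1 := by
  have hr0 := SO.sum_row_sq A 0
  have hr1 := SO.sum_row_sq A 1
  have hc0 := SO.sum_col_sq A 0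
  have hc1 := SO.sum_col_sq A 1
  have hdet := SO.det_eq_one A
  rw [Matrix.det_fin_three] at hdet
  simp only [Fin.sum_univ_three, h0, h1] at hr0 hr1 hc0 hc1 hdet
  obtain ⟨e01, e02, -⟩ := eq_zero_of_sum_three_sq
    (show A.1 0 1 ^ 2 + A.1 0 2 ^ 2 + 0 ^ 2 = 0 by linarith)
  obtain ⟨e10, e12, -⟩ := eq_zero_of_sum_three_sq
    (show A.1 1 0 ^ 2 + A.1 1 2 ^ 2 + 0 ^ 2 = 0 by linarith)
  obtain ⟨-, e20, -⟩ := eq_zero_of_sum_three_sq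
    (show A.1 1 0 ^ 2 + A.1 2 0 ^ 2 + 0 ^ 2 = 0 by linarith)
  obtain ⟨-, e21, -⟩ := eq_zero_of_sum_three_sq
    (show A.1 0 1 ^ 2 + A.1 2 1 ^ 2 + 0 ^ 2 = 0 by linarith)
  rw [e01, e02, e10, e12, e20, e21] at hdet
  have e22 : A.1 2 2 = 1 := by linarith
  ext a b
  fin_cases a <;> fin_cases b <;> simp [h0, h1, e01, e02, e10, e12, e20, e21, e22]

theorem eq_of_relRot {P R : SO 3} (h : (relRot P R).1 = 1) : P = R := by
  rw [coe_relRot] at h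
  refine Subtype.ext ?_
  calc P.1 = P.1 * (R.1ᵀ * R.1) := by rw [SO.transpose_mul_self, Matrix.mul_one]
    _ = R.1 := by rw [← Matrix.mul_assoc, h, Matrix.one_mul]

/-- Three distinct coplanar unit vectors. -/
def axes : Fin 3 → EuclideanSpace ℝ (Fin 3) := ![!₂[0, 1, 0], !₂[1, 0, 0], !₂[3 / 5, 4 / 5, 0]]

theorem norm_axes (c : Fin 3) : ‖axes c‖ = 1 := by
  have h : ‖axes c‖ ^ 2 = 1 := by
    rw [EuclideanSpace.real_norm_sq_eq, Fin.sum_univ_three]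
    fin_cases c <;> (simp [axes]; try norm_num)
  have := norm_nonneg (axes c)
  nlinarith

/-- Rotations that agree on the axes of a triangle of coplanar axes are equal. -/
theorem triangle_rigid {P R S : SO 3}
    (h1 : P.1ᵀ *ᵥ (axes 1).ofLp = R.1ᵀ *ᵥ (axes 1).ofLp)
    (h0 : R.1ᵀ *ᵥ (axes 0).ofLp = S.1ᵀ *ᵥ (axes 0).ofLp)
    (h2 : S.1ᵀ *ᵥ (axes 2).ofLp = P.1ᵀ *ᵥ (axes 2).ofLp) : P = R ∧ R = S := by
  have e1 : ∀ c, P.1 0 c = R.1 0 c := fun c => by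
    simpa [axes, Matrix.mulVec, dotProduct, Fin.sum_univ_three] using congrFun h1 c
  have e0 : ∀ c, R.1 1 c = S.1 1 c := fun c => by
    simpa [axes, Matrix.mulVec, dotProduct, Fin.sum_univ_three] using congrFun h0 c
  have e2 : ∀ c, 3 * (S.1 0 c - R.1 0 c) = 4 * (P.1 1 c - R.1 1 c) := fun c => by
    have h := congrFun h2 c
    simp [axes, Matrix.mulVec, dotProduct, Fin.sum_univ_three] at h
    rw [e1 c, ← e0 c] at h
    linarith
  have horth : ∀ A : SO 3, A.1 0 0 * A.1 1 0 + A.1 0 1 * A.1 1 1 + A.1 0 2 * A.1 1 2 = 0 :=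
    fun A => by
      have h := congrFun (congrFun (SO.mul_transpose_self A) 0) 1
      simpa [Matrix.mul_apply, Fin.sum_univ_three] using h
  have hRR := horth R
  have hSS := horth S
  have hPP := horth P
  have hnR := SO.sum_row_sq R 0
  have hnS := SO.sum_row_sq S 0
  rw [Fin.sum_univ_three] at hnR hnS
  simp only [e1, ← e0] at hPP hSS
  have q : ∀ c, P.1 1 c = R.1 1 c + 3 / 4 * (S.1 0 c - R.1 0 c) := fun c => by
    linarith [e2 c]
  simp only [q] at hPP
  -- Let `r`, `s` be the first rows of `R`, `S`. Orthogonality of the first two rows of `P` and of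
  -- `R` gives `r · (s - r) = 0`; as both are unit vectors, `‖s - r‖² = 0`.
  obtain ⟨d0, d1, d2⟩ := eq_zero_of_sum_three_sq
    (show (S.1 0 0 - R.1 0 0) ^ 2 + (S.1 0 1 - R.1 0 1) ^ 2 + (S.1 0 2 - R.1 0 2) ^ 2 = 0 by
      linear_combination hnS - hnR - 8 / 3 * (hPP - hRR))
  have d : ∀ c, R.1 0 c = S.1 0 c := fun c => by
    fin_cases c
    · exact (sub_eq_zero.1 d0).symm
    · exact (sub_eq_zero.1 d1).symm
    · exact (sub_eq_zero.1 d2).symm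
  have q' : ∀ c, P.1 1 c = R.1 1 c := fun c => by
    rw [q c, d c]
    ring
  have hagree : ∀ A B : SO 3, (∀ c, A.1 0 c = B.1 0 c) → (∀ c, A.1 1 c = B.1 1 c) → A = B := by
    intro A B hA hB
    have hn0 := SO.sum_row_sq B 0
    have hn1 := SO.sum_row_sq B 1
    refine eq_of_relRot (SO.eq_one_of_entries ?_ ?_)
    · rw [coe_relRot, Matrix.mul_apply, ← hn0]
      exact Finset.sum_congr rfl fun c _ => by rw [hA, Matrix.transpose_apply, sq]
    · rw [coe_relRot, Matrix.mul_apply, ← hn1]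
      exact Finset.sum_congr rfl fun c _ => by rw [hB, Matrix.transpose_apply, sq]
  exact ⟨hagree P R e1 q', hagree R S d e0⟩

theorem abs_relRot_sub_one_le {n : ℕ} (P R : SO n) (a b : Fin n) :
    |(relRot P R).1 a b - (1 : Matrix (Fin n) (Fin n) ℝ) a b| ≤ ‖P.1 - R.1‖ := by
  have h : (relRot P R).1 - 1 = (P.1 - R.1) * R.1ᵀ := by
    rw [coe_relRot, Matrix.sub_mul, SO.mul_transpose_self]
  rw [← Matrix.sub_apply, h, ← SO.norm_mul_transpose R]
  exact abs_entry_le_norm _ a b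

theorem relRot_mul {n : ℕ} (P R S : SO n) : (relRot P R).1 * (relRot R S).1 = (relRot P S).1 := by
  rw [coe_relRot, coe_relRot, coe_relRot, Matrix.mul_assoc, ← Matrix.mul_assoc R.1ᵀ,
    SO.transpose_mul_self, Matrix.one_mul]

theorem dotProduct_axes (A : Matrix (Fin 3) (Fin 3) ℝ) :
    (axes 1).ofLp ⬝ᵥ (A *ᵥ (axes 1).ofLp) = A 0 0 ∧
    (axes 0).ofLp ⬝ᵥ (A *ᵥ (axes 0).ofLp) = A 1 1 ∧
    (axes 2).ofLp ⬝ᵥ (A *ᵥ (axes 2).ofLp) =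
      9 / 25 * A 0 0 + 12 / 25 * (A 0 1 + A 1 0) + 16 / 25 * A 1 1 := by
  refine ⟨?_, ?_, ?_⟩
  · simp [axes, Matrix.mulVec, dotProduct, Fin.sum_univ_three]
  · simp [axes, Matrix.mulVec, dotProduct, Fin.sum_univ_three]
  · simp [axes, Matrix.mulVec, dotProduct, Fin.sum_univ_three]
    ring

theorem axial_eq_zero {Z : Matrix (Fin 3) (Fin 3) ℝ} (hZ : Zᵀ = -Z) (h : axial Z = 0) : Z = 0 := by
  have hs : ∀ a b, Z b a = -Z a b := fun a b => congrFun (congrFun hZ a) b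
  have h0 : Z 2 1 = 0 := congrFun h 0
  have h1 : Z 0 2 = 0 := congrFun h 1
  have h2 : Z 1 0 = 0 := congrFun h 2
  have d : ∀ a, Z a a = 0 := fun a => by linarith [hs a a]
  ext a b
  fin_cases a <;> fin_cases b <;> simp [d, h0, h1, h2, hs 2 1, hs 0 2, hs 1 0]

/-- Three rotations that are close to each other and in equilibrium on a triangle of coplanar axes
are equal. -/
theorem triangle_equilibrium {P R S : SO 3} {Z : Matrix (Fin 3) (Fin 3) ℝ}
    (hPR : ‖P.1 - R.1‖ ≤ 1 / 4) (hRS : ‖R.1 - S.1‖ ≤ 1 / 4) (hSP : ‖S.1 - P.1‖ ≤ 1 / 4)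
    (h1 : sk (P.1ᵀ * proj (axes 1) * R.1) = Z) (h0 : sk (R.1ᵀ * proj (axes 0) * S.1) = Z)
    (h2 : sk (S.1ᵀ * proj (axes 2) * P.1) = Z) : P = R ∧ R = S := by
  have c1 := fun a b => abs_le.1 ((abs_relRot_sub_one_le P R a b).trans hPR)
  have c0 := fun a b => abs_le.1 ((abs_relRot_sub_one_le R S a b).trans hRS)
  have c2 := fun a b => abs_le.1 ((abs_relRot_sub_one_le S P a b).trans hSP)
  have n1 := norm_sk_edge_sq P R (norm_axes 1)
  have n0 := norm_sk_edge_sq R S (norm_axes 0)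
  have n2 := norm_sk_edge_sq S P (norm_axes 2)
  rw [← coe_relRot, (dotProduct_axes _).1, h1] at n1
  rw [← coe_relRot, (dotProduct_axes _).2.1, h0] at n0
  rw [← coe_relRot, (dotProduct_axes _).2.2, h2] at n2
  set A := relRot P R with hA
  set B := relRot R S with hB
  set C := relRot S P with hC
  set γ := 9 / 25 * C.1 0 0 + 12 / 25 * (C.1 0 1 + C.1 1 0) + 16 / 25 * C.1 1 1 with hγ
  have pA : 3 / 4 ≤ A.1 0 0 := by
    have := (c1 0 0).1
    simp at this
    linarith
  have pB : 3 / 4 ≤ B.1 1 1 := by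
    have := (c0 1 1).1
    simp at this
    linarith
  have pC : 1 / 2 ≤ γ := by
    have t1 := (c2 0 0).1
    have t2 := (c2 0 1).1
    have t3 := (c2 1 0).1
    have t4 := (c2 1 1).1
    simp at t1 t2 t3 t4
    linarith
  -- The three edge terms have equal norms, so the cosines agree up to sign; closeness makes them
  -- all positive.
  have eAB : A.1 0 0 = B.1 1 1 := by nlinarith
  have eAC : A.1 0 0 = γ := by nlinarith
  have hone : A.1 0 0 = 1 := by
    by_cases hz : axial Z = 0
    · have hZ0 : Z = 0 := axial_eq_zero (by rw [← h1, transpose_sk]) hz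
      rw [hZ0, norm_zero] at n1
      nlinarith
    -- For `z = axial Z ≠ 0`, the image of `z` under each rotation is orthogonal to two independent
    -- horizontal axes, hence parallel to the third axis. The relative rotations are then planar,
    -- with a common cosine `α`.
    · have l1 := dotProduct_mulVec_axial_left P R (axes 1)
      have r1 := dotProduct_mulVec_axial_right P R (axes 1)
      have l0 := dotProduct_mulVec_axial_left R S (axes 0)
      have r0 := dotProduct_mulVec_axial_right R S (axes 0)
      have l2 := dotProduct_mulVec_axial_left S P (axes 2)
      have r2 := dotProduct_mulVec_axial_right S P (axes 2)
      rw [h1] at l1 r1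
      rw [h0] at l0 r0
      rw [h2] at l2 r2
      have d1 : ∀ w : Fin 3 → ℝ, (axes 1).ofLp ⬝ᵥ w = w 0 := fun w => by
        simp [axes, dotProduct, Fin.sum_univ_three]
      have d0 : ∀ w : Fin 3 → ℝ, (axes 0).ofLp ⬝ᵥ w = w 1 := fun w => by
        simp [axes, dotProduct, Fin.sum_univ_three]
      have d2 : ∀ w : Fin 3 → ℝ, (axes 2).ofLp ⬝ᵥ w = 3 / 5 * w 0 + 4 / 5 * w 1 := fun w => by
        simp [axes, dotProduct, Fin.sum_univ_three]
      rw [d1] at l1 r1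
      rw [d0] at l0 r0
      rw [d2] at l2 r2
      have P1 : (P.1 *ᵥ axial Z) 1 = 0 := by linarith
      have S0 : (S.1 *ᵥ axial Z) 0 = 0 := by linarith
      have pos1 : 0 < A.1 2 2 := by
        have := (c1 2 2).1
        simp at this
        linarith
      have pos0 : 0 < B.1 2 2 := by
        have := (c0 2 2).1
        simp at this
        linarith
      have pos2 : 0 < C.1 2 2 := by
        have := (c2 2 2).1
        simp at this
        linarith
      obtain ⟨a1, a2, a3⟩ := relRot_axis hz l1 P1 r1 l0 pos1
      obtain ⟨b1, b2, b3⟩ := relRot_axis hz r1 l0 S0 r0 pos0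
      obtain ⟨g1, g2, g3⟩ := relRot_axis hz S0 r0 l1 P1 pos2
      obtain ⟨-, -, A1, A2, A3⟩ := SO.planar_of_axis a1 a2 a3
      obtain ⟨-, -, B1, B2, B3⟩ := SO.planar_of_axis b1 b2 b3
      obtain ⟨-, -, C1, C2, C3⟩ := SO.planar_of_axis g1 g2 g3
      have hγ' : γ = C.1 0 0 := by
        rw [hγ, C1, C2]
        ring
      have hcomp : A.1 * B.1 = C.1ᵀ := by
        rw [hA, hB, hC, relRot_mul, coe_relRot, coe_relRot, Matrix.transpose_mul,
          Matrix.transpose_transpose]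
      have hent := congrFun (congrFun hcomp 0) 0
      rw [Matrix.mul_apply, Fin.sum_univ_three, Matrix.transpose_apply, ← hγ', ← eAC, a1, A2,
        ← B1, ← eAB] at hent
      rw [← B1, ← eAB] at B3
      set α := A.1 0 0
      -- The planar rotations compose to the identity around the triangle, so `α² - sin · sin = α`.
      -- Squaring and using `sin² = 1 - α²` gives `(1 - α)² (1 + 2α) = 0`; the second root, angles
      -- of 120 degrees, is excluded by closeness.
      have hprod : A.1 1 0 * B.1 1 0 = α ^ 2 - α := by linarith
      have hsq : (1 - α ^ 2) * (1 - α ^ 2) = (α ^ 2 - α) ^ 2 := by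
        rw [← hprod, mul_pow]
        have e1 : 1 - α ^ 2 = A.1 1 0 ^ 2 := by linarith
        have e2 : 1 - α ^ 2 = B.1 1 0 ^ 2 := by linarith
        nth_rewrite 1 [e1]
        rw [e2]
      have hfac : (1 - α) ^ 2 * (1 + 2 * α) = 0 := by linear_combination hsq
      rcases mul_eq_zero.1 hfac with h | h
      · have := pow_eq_zero_iff (two_ne_zero) |>.1 h
        linarith
      · linarith
  refine triangle_rigid ?_ ?_ ?_
  · refine transpose_mulVec_eq_of_dotProduct P R (norm_axes 1) ?_
    rw [← coe_relRot, (dotProduct_axes _).1]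
    exact hone
  · refine transpose_mulVec_eq_of_dotProduct R S (norm_axes 0) ?_
    rw [← coe_relRot, (dotProduct_axes _).2.1]
    exact eAB.symm.trans hone
  · refine transpose_mulVec_eq_of_dotProduct S P (norm_axes 2) ?_
    rw [← coe_relRot, (dotProduct_axes _).2.2]
    exact eAC.symm.trans hone

end Triangle

/-! ### The triangle separating asymptotic from exponential stability -/

section Example

attribute [local instance] Matrix.frobeniusNormedAddCommGroup Matrix.frobeniusNormedSpace

/-- The reference vectors of the triangle: each edge carries the axis of the opposite vertex. -/
def triangleReference (i j : Fin 3) : EuclideanSpace ℝ (Fin 3) := axes (i + j)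

theorem isReference_triangle :
    IsReference (⊤ : SimpleGraph (Fin 3)) triangleReference where
  symm i j _ := by rw [triangleReference, triangleReference, add_comm]
  unit i j _ := norm_axes _

/-- Edge terms are antisymmetric, so vanishing velocities at agents `0` and `1` force one common
value `Z` on the cyclically oriented edges. The level `1 / 16` makes all pairwise distances at most
`1 / 4`. -/
theorem isolatedEquilibria_triangle :
    IsolatedEquilibria (⊤ : SimpleGraph (Fin 3)) triangleReference (1 / 16) := by
  intro Q hQ hvel
  have hclose : ∀ i j, ‖(Q i).1 - (Q j).1‖ ≤ 1 / 4 := fun i j => by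
    have := norm_sub_sq_le_spread Q i j
    refine le_of_sq_le_sq ?_ (by norm_num)
    linarith
  have hanti : ∀ i j, sk ((Q j).1ᵀ * proj (triangleReference j i) * (Q i).1) =
      -sk ((Q i).1ᵀ * proj (triangleReference i j) * (Q j).1) := fun i j => by
    rw [← sk_transpose, triangleReference, triangleReference, add_comm j i]
    simp [Matrix.transpose_mul, transpose_proj, Matrix.mul_assoc]
  have n0 : (⊤ : SimpleGraph (Fin 3)).neighborFinset 0 = {1, 2} := by decide
  have n1 : (⊤ : SimpleGraph (Fin 3)).neighborFinset 1 = {0, 2} := by decide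
  have v0 := hvel 0
  have v1 := hvel 1
  rw [bodyVelocity, n0, Finset.sum_pair (by decide)] at v0
  rw [bodyVelocity, n1, Finset.sum_pair (by decide)] at v1
  have h12 : sk ((Q 1).1ᵀ * proj (triangleReference 1 2) * (Q 2).1) =
      sk ((Q 0).1ᵀ * proj (triangleReference 0 1) * (Q 1).1) := by
    rw [hanti 0 1, neg_add_eq_zero] at v1
    exact v1.symm
  have h20 : sk ((Q 2).1ᵀ * proj (triangleReference 2 0) * (Q 0).1) =
      sk ((Q 0).1ᵀ * proj (triangleReference 0 1) * (Q 1).1) := by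
    rw [hanti 0 2]
    exact (eq_neg_of_add_eq_zero_left v0).symm
  obtain ⟨e1, e2⟩ := triangle_equilibrium (hclose 0 1) (hclose 1 2) (hclose 2 0) rfl h12 h20
  rw [spread_eq_zero_iff]
  have hall : ∀ i, Q i = Q 0 := fun i => by
    fin_cases i
    · rfl
    · exact e1.symm
    · exact (e1.trans e2).symm
  exact fun i j => (hall i).trans (hall j).symm

theorem not_infRigid_triangle :
    ¬ InfRigid (⊤ : SimpleGraph (Fin 3)) triangleReference := by
  intro h
  -- The axial vectors are `(3, 4, 0)`, `(0, 4, 0)` and `0`. Each difference is parallel to the axis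
  -- of its edge, as coplanarity permits: `(3, 4, 0) = 3 e₁ + 4 e₂`.
  have := h ![!![0, 0, 4; 0, 0, -3; -4, 3, 0], !![0, 0, 4; 0, 0, 0; -4, 0, 0], 0] ?_ ?_ 0 2
  · have h1 := congrFun (congrFun this 0) 2
    exact four_ne_zero (show (4 : ℝ) = 0 from h1)
  · intro i
    ext a b
    fin_cases i <;> fin_cases a <;> fin_cases b <;> simp
  · intro i j _
    rw [proj_mul_eq_zero_iff (isReference_triangle.unit i j ‹_›)]
    ext c
    fin_cases i <;> fin_cases j <;> fin_cases c <;>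
      simp [axes, triangleReference, Matrix.mulVec, dotProduct, Fin.sum_univ_three] <;> norm_num

theorem finrank_skewMatrices_three : Module.finrank ℝ (skewMatrices 3) = 3 * (3 - 1) / 2 := by
  let e : skewMatrices 3 ≃ₗ[ℝ] (Fin 3 → ℝ) :=
    { toFun := fun Z => axial Z.1
      map_add' := fun A B => by
        ext c
        fin_cases c <;> rfl
      map_smul' := fun r A => by
        ext c
        fin_cases c <;> rfl
      invFun := fun z => ⟨!![0, -z 2, z 1; z 2, 0, -z 0; -z 1, z 0, 0], by
        change _ᵀ = -_
        ext a b
        fin_cases a <;> fin_cases b <;> simp⟩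
      left_inv := fun Z => by
        have hs : ∀ a b, Z.1 b a = -Z.1 a b := fun a b => congrFun (congrFun Z.2 a) b
        have d : ∀ a, Z.1 a a = 0 := fun a => by linarith [hs a a]
        refine Subtype.ext (Matrix.ext fun a b => ?_)
        fin_cases a <;> fin_cases b <;> simp [axial, d, hs 2 1, hs 0 2, hs 1 0]
      right_inv := fun z => by
        ext c
        fin_cases c <;> simp [axial] }
  rw [e.finrank_eq]
  simp

end Example

end PartialSync
end

theorem mainTheorem1 :
    (∀ (n k : ℕ), 2 ≤ n → 1 ≤ k →
      ∀ (G : SimpleGraph (Fin k)) [DecidableRel G.Adj]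
        (y : Fin k → Fin k → EuclideanSpace ℝ (Fin n)), PartialSync.IsReference G y →
        -- (a)
        ((PartialSync.genLaplacian G y).rank = n * (k - 1) →
          PartialSync.outputSync G y = PartialSync.stateSync k n ∧
          PartialSync.LocallyExponentiallyStable G y (PartialSync.stateSync k n)) ∧
        -- (b)
        (∀ V : Matrix (Fin n × (Fin k × Fin n)) (Fin (k * (n * (n - 1) / 2))) ℝ,
          PartialSync.IsSkewBasis V →
          (PartialSync.LocallyExponentiallyStable G y (PartialSync.stateSync k n) ↔
            (Vᵀ * ((1 : Matrix (Fin n) (Fin n) ℝ) ⊗ₖ PartialSync.genLaplacian G y) * V).rank =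
              (k - 1) * (n * (n - 1) / 2)))) ∧
    -- asymptotic stability without exponential stability occurs when the rank condition fails
    (∃ (n k : ℕ) (_ : 2 ≤ n) (_ : 1 ≤ k) (G : SimpleGraph (Fin k)) (_ : DecidableRel G.Adj)
        (y : Fin k → Fin k → EuclideanSpace ℝ (Fin n))
        (V : Matrix (Fin n × (Fin k × Fin n)) (Fin (k * (n * (n - 1) / 2))) ℝ),
        PartialSync.IsReference G y ∧
        PartialSync.IsSkewBasis V ∧
        (Vᵀ * ((1 : Matrix (Fin n) (Fin n) ℝ) ⊗ₖ PartialSync.genLaplacian G y) * V).rank ≠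
          (k - 1) * (n * (n - 1) / 2) ∧
        PartialSync.LocallyAsymptoticallyStable G y (PartialSync.stateSync k n) ∧
        ¬ PartialSync.LocallyExponentiallyStable G y (PartialSync.stateSync k n)) := by
  refine ⟨fun n k _ hk G _ y hy => ⟨fun hr => ⟨?_, ?_⟩, fun V hV => ?_⟩, ?_⟩
  · exact PartialSync.outputSync_eq_of_rank_genLaplacian hk hy hr
  · exact (PartialSync.infRigid_of_rank_genLaplacian hk hr).locallyExponentiallyStable hk hy
  · rw [hV.rank_eq_iff hk hy]
    exact ⟨fun h => h.infRigid hk hy, fun h => h.locallyExponentiallyStable hk hy⟩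
  · obtain ⟨V, hV⟩ := PartialSync.exists_isSkewBasis (k := 3)
      PartialSync.finrank_skewMatrices_three
    have hk : 1 ≤ 3 := by norm_num
    have hy := PartialSync.isReference_triangle
    refine ⟨3, 3, by norm_num, hk, ⊤, inferInstance, PartialSync.triangleReference, V, hy, hV,
      fun h => ?_, ?_, fun h => ?_⟩
    · exact PartialSync.not_infRigid_triangle ((hV.rank_eq_iff hk hy).1 h)
    · exact PartialSync.isolatedEquilibria_triangle.locallyAsymptoticallyStable hk hy (by norm_num)
    · exact PartialSync.not_infRigid_triangle (h.infRigid hk hy)
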